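/- Let $\mathcal H$ be a separable quaternionic Hilbert space, i.e. a right vector space over the quaternions $\mathbb H$ with an $\mathbb H$-valued scalar product $\langle\cdot,\cdot\rangle$ that is right linear in the second argument, satisfies $\langle x,y\rangle=\overline{\langle y,x\rangle}$, is positive definite, and such that $\mathcal H$ is complete and separable for the norm $\|x\|=\sqrt{\langle x,x\rangle}$. Let $J$ be a bounded right linear operator on $\mathcal H$ that is anti-selfadjoint ($J^*=-J$) and unitary ($J^*=J^{-1}$), let $i\in\mathbb H$ be an imaginary unit ($\operatorname{Re} i=0$, $|i|=1$), and let $\mathbb C_i=\{a_0+ia_1: a_0,a_1\in\mathbb R\}$, which is identified with $\mathbb C$. Let $\mathcal H_+^{Ji}=\{x\in\mathcal H: Jx=xi\}$; it is a complex Hilbert space over $\mathbb C_i$ with the right multiplication by scalars of $\mathbb C_i$ and the restriction of $\langle\cdot,\cdot\rangle$. The bounded right linear operators $T$ on $\mathcal H$ with $TJ=JT$ form a vector space $\mathcal B_J(\mathcal H)$ over $\mathbb C_i$, where $(a_0+ia_1)T=a_0T+a_1JT$. For a compact operator $T$ (on $\mathcal H$, or on a complex Hilbert space) let $(\lambda_n(T))_{n}$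 be its sequence of singular values, i.e. the eigenvalues of $|T|=\sqrt{T^*T}$ in decreasing order, repeated according to multiplicity (and continued by zeros if there are only finitely many positive ones). For $p\in(0,\infty]$ let $S_p(J)$ be the set of compact right linear operators $T$ on $\mathcal H$ with $TJ=JT$ and $(\lambda_n(T))_n\in\ell^p$, and let $S_p(\mathcal H_+^{Ji})$ be the set of compact $\mathbb C_i$-linear operators on $\mathcal H_+^{Ji}$ whose singular values are in $\ell^p$. In both cases put $\|T\|_p=\big(\sum_n\lambda_n(T)^p\big)^{1/p}$ for $p<\infty$ and $\|T\|_\infty=\sup_n\lambda_n(T)$. Then, for every $p\in(0,\infty]$, $S_p(J)$ and $S_p(\mathcal H_+^{Ji})$ are $\mathbb C_i$-linear subspaces of $\mathcal B_J(\mathcal H)$ and of the bounded operators on $\mathcal H_+^{Ji}$ respectively, and the restriction $T\mapsto T|_{\mathcal H_+^{Ji}}$ is a $\mathbb C_i$-linear isomorphism of $S_p(J)$ onto $S_p(\mathcal H_+^{Ji})$ with $\big\|T|_{\mathcal H_+^{Ji}}\big\|_p=\|T\|_p$ for all $T\in S_p(J)$. If moreover $p\ge 1$, then $\|\cdot\|_p$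 is a norm on $S_p(J)$ and on $S_p(\mathcal H_+^{Ji})$, and both are Banach spaces over $\mathbb C_i$ for it; in particular $S_p(J)$ is isometrically isomorphic to $S_p(\mathcal H_+^{Ji})$. -/

import Mathlib

open scoped Quaternion ENNReal
open MulOpposite (op)

noncomputable section

/-- Inner product structure on a right vector space over the quaternions (a module over
`ℍ[ℝ]ᵐᵒᵖ`; `op a • x` is the right multiple `x a`), whose norm is `‖x‖ = √⟨x, x⟩`.
A quaternionic Hilbert space is such a space that is moreover complete. -/
class QuaternionicInnerProductSpace (H : Type*) [NormedAddCommGroup H] [Module ℍ[ℝ]ᵐᵒᵖ H] where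
  /-- The quaternionic scalar product, right linear in the second argument. -/
  qinner : H → H → ℍ[ℝ]
  qinner_self : ∀ x, qinner x x = ((‖x‖ ^ 2 : ℝ) : ℍ[ℝ])
  qinner_add_right : ∀ x y z, qinner x (y + z) = qinner x y + qinner x z
  qinner_smul_right : ∀ (x y : H) (a : ℍ[ℝ]), qinner x (op a • y) = qinner x y * a
  star_qinner : ∀ x y, star (qinner y x) = qinner x y

/-- The sphere `𝕊` of imaginary units of the quaternions. -/
structure ImaginaryUnit where
  val : ℍ[ℝ]
  re_eq_zero : val.re = 0
  norm_eq_one : ‖val‖ = 1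

namespace ImaginaryUnit

variable (i : ImaginaryUnit)

theorem sq_sum : i.val.imI ^ 2 + i.val.imJ ^ 2 + i.val.imK ^ 2 = 1 := by
  have h := Quaternion.normSq_eq_norm_mul_self i.val
  rw [i.norm_eq_one, Quaternion.normSq_def', i.re_eq_zero] at h
  linarith

/-- The identification of `ℂ` with the complex plane `ℂ_i`, `a₀ + a₁ I ↦ a₀ + a₁ i`. -/
def embed : ℂ →+* ℍ[ℝ] where
  toFun z := (z.re : ℍ[ℝ]) + (z.im : ℍ[ℝ]) * i.val
  map_one' := by simp
  map_zero' := by simp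
  map_add' z w := by simp [add_mul]; abel
  map_mul' z w := by
    have h := i.sq_sum
    have h0 := i.re_eq_zero
    ext
    · simp [h0]
      linear_combination (z.im * w.im) * h
    all_goals simp [h0]; ring

/-- The orthogonal projection of the quaternions onto `ℂ_i`, read in `ℂ`. -/
def proj (q : ℍ[ℝ]) : ℂ := ⟨q.re, -(i.val * q).re⟩

theorem proj_embed (z : ℂ) : i.proj (i.embed z) = z := by
  have h := i.sq_sum
  have h0 := i.re_eq_zero
  apply Complex.ext
  · simp [proj, embed, h0]
  · simp [proj, embed, h0]
    linear_combination z.im * h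

theorem proj_add (p q : ℍ[ℝ]) : i.proj (p + q) = i.proj p + i.proj q := by
  apply Complex.ext <;> simp [proj, mul_add]; ring

theorem proj_mul_embed (q : ℍ[ℝ]) (z : ℂ) : i.proj (q * i.embed z) = i.proj q * z := by
  have h := i.sq_sum
  have h0 := i.re_eq_zero
  apply Complex.ext
  · simp [proj, embed, h0]; ring
  · simp [proj, embed, h0]
    linear_combination (q.re * z.im) * h

theorem proj_star (q : ℍ[ℝ]) : i.proj (star q) = starRingEnd ℂ (i.proj q) := by
  have h0 := i.re_eq_zero
  apply Complex.ext <;> simp [proj, h0]; ring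

/-- A quaternion that commutes with `i` lies in `ℂ_i`. -/
theorem embed_proj {q : ℍ[ℝ]} (hq : q * i.val = i.val * q) : i.embed (i.proj q) = q := by
  have h := i.sq_sum
  have h0 := i.re_eq_zero
  have hI := congrArg QuaternionAlgebra.imI hq
  have hJ := congrArg QuaternionAlgebra.imJ hq
  have hK := congrArg QuaternionAlgebra.imK hq
  simp [h0] at hI hJ hK
  ext
  · simp [proj, embed, h0]
  · simp [proj, embed, h0]
    linear_combination q.imI * h - i.val.imJ * hK / 2 + i.val.imK * hJ / 2
  · simp [proj, embed, h0]
    linear_combination q.imJ * h - i.val.imK * hI / 2 + i.val.imI * hK / 2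
  · simp [proj, embed, h0]
    linear_combination q.imK * h - i.val.imI * hJ / 2 + i.val.imJ * hI / 2

/-- One imaginary unit, used only to prove the existence of adjoints and square roots. -/
def std : ImaginaryUnit where
  val := ⟨0, 1, 0, 0⟩
  re_eq_zero := rfl
  norm_eq_one := by
    have h : ∀ q : ℍ[ℝ], q.re ^ 2 + q.imI ^ 2 + q.imJ ^ 2 + q.imK ^ 2 = 1 → ‖q‖ = 1 := by
      intro q hq
      rw [← Quaternion.normSq_def', Quaternion.normSq_eq_norm_mul_self] at hq
      nlinarith [norm_nonneg q]
    exact h _ (by norm_num)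

end ImaginaryUnit

section Space

open QuaternionicInnerProductSpace

set_option linter.unusedSectionVars false

variable {H : Type*} [NormedAddCommGroup H] [Module ℍ[ℝ]ᵐᵒᵖ H] [QuaternionicInnerProductSpace H]

theorem qinner_add_left (x y z : H) : qinner (x + y) z = qinner x z + qinner y z := by
  rw [← star_qinner, qinner_add_right, star_add, star_qinner, star_qinner]

theorem qinner_smul_left (x y : H) (a : ℍ[ℝ]) : qinner (op a • x) y = star a * qinner x y := by
  rw [← star_qinner, qinner_smul_right, star_mul, star_qinner]

theorem norm_op_smul (a : ℍ[ℝ]) (x : H) : ‖op a • x‖ = ‖x‖ * ‖a‖ := by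
  have h : qinner (op a • x) (op a • x) = ((‖x‖ ^ 2 * ‖a‖ ^ 2 : ℝ) : ℍ[ℝ]) := by
    rw [qinner_smul_right, qinner_smul_left, qinner_self, mul_assoc, Quaternion.coe_mul_eq_smul,
      mul_smul_comm, Quaternion.star_mul_self, Quaternion.normSq_eq_norm_mul_self, ← sq,
      ← Quaternion.coe_mul_eq_smul, ← Quaternion.coe_mul]
  rw [qinner_self, Quaternion.coe_inj, ← mul_pow] at h
  exact (sq_eq_sq₀ (norm_nonneg _) (by positivity)).1 h

variable (H) in
/-- The space `H` regarded as a complex vector space: `z • x = x z` with `z` read in `ℂ_i`. -/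
def RightComplex (_i : ImaginaryUnit) : Type _ := H

namespace RightComplex

variable (i : ImaginaryUnit)

instance : NormedAddCommGroup (RightComplex H i) := inferInstanceAs (NormedAddCommGroup H)

instance : Module ℍ[ℝ]ᵐᵒᵖ (RightComplex H i) := inferInstanceAs (Module ℍ[ℝ]ᵐᵒᵖ H)

instance : QuaternionicInnerProductSpace (RightComplex H i) :=
  inferInstanceAs (QuaternionicInnerProductSpace H)

instance [CompleteSpace H] : CompleteSpace (RightComplex H i) := inferInstanceAs (CompleteSpace H)

theorem norm_embed (z : ℂ) : ‖i.embed z‖ = ‖z‖ := by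
  have h := i.sq_sum
  have h0 := i.re_eq_zero
  rw [← sq_eq_sq₀ (norm_nonneg _) (norm_nonneg _), sq, ← Quaternion.normSq_eq_norm_mul_self,
    Quaternion.normSq_def', Complex.sq_norm, Complex.normSq_apply]
  simp [ImaginaryUnit.embed, h0]
  linear_combination z.im ^ 2 * h

/-- The scalar multiplication is `z • x = x z`, and the complex scalar product is the
`ℂ_i`-component of the quaternionic one. -/
instance : InnerProductSpace ℂ (RightComplex H i) where
  smul z x := op (i.embed z) • x
  one_smul x := by change op (i.embed 1) • x = x; simp
  mul_smul z w x := by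
    change op (i.embed (z * w)) • x = op (i.embed z) • op (i.embed w) • x
    rw [smul_smul, ← MulOpposite.op_mul, mul_comm z w, map_mul]
  smul_zero z := smul_zero (op (i.embed z))
  smul_add z x y := smul_add (op (i.embed z)) x y
  add_smul z w x := by
    change op (i.embed (z + w)) • x = op (i.embed z) • x + op (i.embed w) • x
    rw [map_add, MulOpposite.op_add, add_smul]
  zero_smul x := by change op (i.embed 0) • x = 0; simp
  inner x y := i.proj (qinner x y)
  norm_smul_le z x := by
    change ‖op (i.embed z) • x‖ ≤ _
    rw [norm_op_smul, norm_embed, mul_comm]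
  norm_sq_eq_re_inner x := by
    change _ = (i.proj (qinner x x)).re
    rw [qinner_self]; rfl
  conj_inner_symm x y := by
    change starRingEnd ℂ (i.proj (qinner y x)) = i.proj (qinner x y)
    rw [← i.proj_star, star_qinner]
  add_left x y z := by
    change i.proj (qinner (x + y) z) = i.proj (qinner x z) + i.proj (qinner y z)
    rw [qinner_add_left, i.proj_add]
  smul_left x y z := by
    change i.proj (qinner (op (i.embed z) • x) y) = starRingEnd ℂ z * i.proj (qinner x y)
    rw [← star_qinner, qinner_smul_right, i.proj_star,
      i.proj_mul_embed, map_mul, ← i.proj_star, star_qinner, mul_comm]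

theorem smul_def (z : ℂ) (x : RightComplex H i) : z • x = op (i.embed z) • x := rfl

theorem inner_def (x y : RightComplex H i) : inner ℂ x y = i.proj (qinner x y) := rfl

/-- A bounded quaternionic operator, regarded as a complex linear operator. -/
def ofQ (T : H →L[ℍ[ℝ]ᵐᵒᵖ] H) : RightComplex H i →L[ℂ] RightComplex H i where
  toFun x := T x
  map_add' x y := map_add T x y
  map_smul' z x := map_smul T (op (i.embed z)) x
  cont := T.continuous

end RightComplex

/-- Quaternions are determined by the `ℂ_i`-components of their right multiples. -/
theorem eq_of_proj_mul (i : ImaginaryUnit) {p q : ℍ[ℝ]}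
    (h : ∀ a, i.proj (p * a) = i.proj (q * a)) : p = q := by
  have key : ∀ a : ℍ[ℝ], (p * a).re = (q * a).re := fun a => congrArg Complex.re (h a)
  have h1 := key 1
  simp only [Quaternion.re_mul] at key
  have h2 := key (⟨0, 1, 0, 0⟩ : ℍ[ℝ])
  have h3 := key (⟨0, 0, 1, 0⟩ : ℍ[ℝ])
  have h4 := key (⟨0, 0, 0, 1⟩ : ℍ[ℝ])
  simp at h1 h2 h3 h4
  ext <;> assumption

theorem eq_of_qinner {x y : H} (h : ∀ z, qinner x z = qinner y z) : x = y := by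
  have h1 : qinner (x - y) (x - y) = 0 := by
    have h2 : qinner (x - y) (x - y) + qinner y (x - y) = qinner x (x - y) := by
      rw [← qinner_add_left, sub_add_cancel]
    rw [h (x - y)] at h2
    exact add_eq_right.1 h2
  rw [qinner_self, ← Quaternion.coe_zero, Quaternion.coe_inj] at h1
  exact sub_eq_zero.1 (norm_eq_zero.1 ((pow_eq_zero_iff (by norm_num)).1 h1))

section Adjoint

variable [CompleteSpace H]

theorem exists_adjoint (T : H →L[ℍ[ℝ]ᵐᵒᵖ] H) :
    ∃ S : H →L[ℍ[ℝ]ᵐᵒᵖ] H, ∀ x y, qinner (S x) y = qinner x (T y) := by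
  let i := ImaginaryUnit.std
  let A := ContinuousLinearMap.adjoint (RightComplex.ofQ i T)
  let B : H → H := fun x => A x
  have hA : ∀ x y : H, qinner (B x) y = qinner x (T y) := by
    intro x y
    refine eq_of_proj_mul i fun a => ?_
    have h : i.proj (qinner (B x) (op a • y)) = i.proj (qinner x (T (op a • y))) :=
      ContinuousLinearMap.adjoint_inner_left (RightComplex.ofQ i T) (op a • y : H) x
    rwa [map_smul, qinner_smul_right, qinner_smul_right] at h
  refine ⟨⟨⟨⟨B, fun x y => map_add A x y⟩, ?_⟩, A.continuous⟩, hA⟩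
  rintro ⟨a⟩ x
  refine eq_of_qinner fun z => ?_
  change qinner (B (op a • x)) z = qinner (op a • B x) z
  rw [hA, qinner_smul_left, qinner_smul_left, hA]

/-- The adjoint `T*`, characterised by `⟨T* x, y⟩ = ⟨x, T y⟩`. -/
def qadjoint (T : H →L[ℍ[ℝ]ᵐᵒᵖ] H) : H →L[ℍ[ℝ]ᵐᵒᵖ] H := (exists_adjoint T).choose

theorem qadjoint_qinner (T : H →L[ℍ[ℝ]ᵐᵒᵖ] H) (x y : H) :
    qinner (qadjoint T x) y = qinner x (T y) := (exists_adjoint T).choose_spec x y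

end Adjoint

/-- Positivity: `⟨x, T x⟩` is a nonnegative real number for every `x`. -/
def QPositive (T : H →L[ℍ[ℝ]ᵐᵒᵖ] H) : Prop :=
  ∀ x, ∃ r : ℝ, 0 ≤ r ∧ qinner x (T x) = (r : ℍ[ℝ])

theorem continuous_op_smul (a : ℍ[ℝ]) : Continuous fun x : H => op a • x :=
  AddMonoidHomClass.continuous_of_bound (DistribSMul.toAddMonoidHom H (op a)) ‖a‖
    fun x => by rw [DistribSMul.toAddMonoidHom_apply, norm_op_smul, mul_comm]

section Abs

variable [CompleteSpace H]

theorem RightComplex.adjoint_ofQ (i : ImaginaryUnit) (T : H →L[ℍ[ℝ]ᵐᵒᵖ] H) :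
    star (ofQ i T) = ofQ i (qadjoint T) := by
  refine ((ContinuousLinearMap.eq_adjoint_iff _ _).2 fun x y => ?_).symm
  exact congrArg i.proj (qadjoint_qinner T x y)

/-- A map of `H` that is additive, `ℂ_i`-linear and continuous, as a complex operator. -/
def RightComplex.mk (i : ImaginaryUnit) (f : H → H) (hadd : ∀ x y, f (x + y) = f x + f y)
    (hsmul : ∀ (z : ℂ) x, f (op (i.embed z) • x) = op (i.embed z) • f x) (hf : Continuous f) :
    RightComplex H i →L[ℂ] RightComplex H i where
  toFun x := f x
  map_add' x y := hadd x y
  map_smul' z x := hsmul z x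
  cont := hf

theorem RightComplex.nonneg_iff (i : ImaginaryUnit) (A : RightComplex H i →L[ℂ] RightComplex H i) :
    0 ≤ A ↔ ∀ x, ∃ r : ℝ, 0 ≤ r ∧ i.proj (qinner (A x) x) = r := by
  rw [ContinuousLinearMap.nonneg_iff_isPositive, ContinuousLinearMap.isPositive_iff_complex]
  refine forall_congr' fun x => ?_
  rw [RightComplex.inner_def]
  constructor
  · rintro ⟨h1, h2⟩
    exact ⟨_, h2, h1.symm⟩
  · rintro ⟨r, hr, h⟩
    rw [h]
    simpa using hr

theorem RightComplex.ofQ_nonneg (i : ImaginaryUnit) {P : H →L[ℍ[ℝ]ᵐᵒᵖ] H} (hP : QPositive P) :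
    0 ≤ ofQ i P := by
  rw [RightComplex.nonneg_iff]
  intro x
  obtain ⟨r, hr, h⟩ := hP x
  have h' : ∀ x : H, qinner x (P x) = r → i.proj (qinner (P x) x) = (r : ℂ) := by
    intro x h
    rw [← star_qinner, h]
    apply Complex.ext <;> simp [ImaginaryUnit.proj, i.re_eq_zero]
  exact ⟨r, hr, h' x h⟩

theorem exists_complex_abs {K : Type*} [NormedAddCommGroup K] [InnerProductSpace ℂ K]
    [CompleteSpace K] (T : K →L[ℂ] K) : ∃ A : K →L[ℂ] K, 0 ≤ A ∧ A * A = star T * T ∧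
      ∀ C : K →L[ℂ] K, 0 ≤ C → C * C = star T * T → C = A := by
  refine ⟨CFC.abs T, CFC.abs_nonneg T, CFC.abs_mul_abs T, fun C hC h => ?_⟩
  rw [CFC.abs, CFC.sqrt_unique h hC]

/-- Every bounded operator has a modulus: `T* T` has exactly one positive square root. -/
theorem existsUnique_qabs (T : H →L[ℍ[ℝ]ᵐᵒᵖ] H) :
    ∃! P : H →L[ℍ[ℝ]ᵐᵒᵖ] H, QPositive P ∧ P * P = qadjoint T * T := by
  obtain ⟨i, hi1, hi2, hi3⟩ : ∃ i : ImaginaryUnit, i.val.imI = 1 ∧ i.val.imJ = 0 ∧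
      i.val.imK = 0 := ⟨ImaginaryUnit.std, rfl, rfl, rfl⟩
  have hi0 := i.re_eq_zero
  obtain ⟨A, hA0, hAA, huniq⟩ := exists_complex_abs (RightComplex.ofQ i T)
  rw [RightComplex.adjoint_ofQ] at hAA huniq
  let B : H → H := fun x => A x
  have hBB : ∀ x, B (B x) = qadjoint T (T x) := fun x => DFunLike.congr_fun hAA x
  have hBadd : ∀ x y, B (x + y) = B x + B y := fun x y => map_add A x y
  have hBz : ∀ (z : ℂ) x, B (op (i.embed z) • x) = op (i.embed z) • B x :=
    fun z x => map_smul A z (show RightComplex H i from x)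
  have hBcont : Continuous B := A.continuous
  have hBsymm : ∀ x y, i.proj (qinner (B x) y) = i.proj (qinner x (B y)) :=
    fun x y => ((ContinuousLinearMap.nonneg_iff_isPositive A).1 hA0).isSymmetric x y
  have hBpos : ∀ x : H, ∃ r : ℝ, 0 ≤ r ∧ i.proj (qinner (B x) x) = r :=
    (RightComplex.nonneg_iff i A).1 hA0
  obtain ⟨j, hj0, hj1, hj2, hj3⟩ : ∃ j : ℍ[ℝ], j.re = 0 ∧ j.imI = 0 ∧ j.imJ = 1 ∧ j.imK = 0 :=
    ⟨⟨0, 0, 1, 0⟩, rfl, rfl, rfl, rfl⟩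
  have hj : ∀ z : ℂ, i.embed z * j = j * i.embed (starRingEnd ℂ z) := by
    intro z
    ext <;> simp [ImaginaryUnit.embed, hi0, hi1, hi2, hi3, hj0, hj1, hj2, hj3]
  have hjj : j * -j = 1 := by ext <;> simp [hj0, hj1, hj2, hj3]
  have hjj' : -j * j = 1 := by ext <;> simp [hj0, hj1, hj2, hj3]
  have hjs : star (-j) = j := by ext <;> simp [hj0, hj1, hj2, hj3]
  have hconj : ∀ q : ℍ[ℝ], i.proj (j * q * -j) = starRingEnd ℂ (i.proj q) := by
    intro q
    apply Complex.ext <;>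
      simp [ImaginaryUnit.proj, hi0, hi1, hi2, hi3, hj0, hj1, hj2, hj3]
  have hsplit : ∀ q : ℍ[ℝ], ∃ z w : ℂ, q = i.embed z + i.embed w * j := by
    intro q
    refine ⟨⟨q.re, q.imI⟩, ⟨q.imJ, q.imK⟩, ?_⟩
    ext <;> simp [ImaginaryUnit.embed, hi0, hi1, hi2, hi3, hj0, hj1, hj2, hj3]
  have hinv : ∀ x : H, op (-j) • op j • x = x := fun x => by
    rw [smul_smul, ← MulOpposite.op_mul, hjj, MulOpposite.op_one, one_smul]
  have hinv' : ∀ x : H, op j • op (-j) • x = x := fun x => by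
    rw [smul_smul, ← MulOpposite.op_mul, hjj', MulOpposite.op_one, one_smul]
  -- conjugating with the right multiplication by `j` gives another positive square root
  let f : H → H := fun x => op (-j) • B (op j • x)
  let C : RightComplex H i →L[ℂ] RightComplex H i := RightComplex.mk i f
    (fun x y => by simp only [f, smul_add, hBadd])
    (fun z x => by
      have h1 : op j • op (i.embed z) • x = op (i.embed (starRingEnd ℂ z)) • op j • x := by
        rw [smul_smul, smul_smul, ← MulOpposite.op_mul, ← MulOpposite.op_mul, hj]
      have h2 : ∀ y : H, op (-j) • op (i.embed (starRingEnd ℂ z)) • y =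
          op (i.embed z) • op (-j) • y := by
        intro y
        rw [smul_smul, smul_smul, ← MulOpposite.op_mul, ← MulOpposite.op_mul, mul_neg, hj,
          Complex.conj_conj, neg_mul]
      simp only [f]
      rw [h1, hBz, h2])
    ((continuous_op_smul (-j)).comp (hBcont.comp (continuous_op_smul j)))
  have hC0 : 0 ≤ C := by
    rw [RightComplex.nonneg_iff]
    intro x
    obtain ⟨r, hr, h⟩ := hBpos (op j • (x : H))
    have h1 : ∀ x : H, i.proj (qinner (B (op j • x)) (op j • x)) = r →
        i.proj (qinner (f x) x) = r := by
      intro x hx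
      have h2 : qinner (f x) x = j * qinner (B (op j • x)) (op j • x) * -j := by
        rw [mul_assoc, ← qinner_smul_right, hinv, ← hjs, ← qinner_smul_left]
        simp only [f, hjs]
      rw [h2, hconj, hx, Complex.conj_ofReal]
    exact ⟨r, hr, h1 x h⟩
  have hCA : C = A := by
    refine huniq C hC0 (ContinuousLinearMap.ext fun x => ?_)
    have h1 : ∀ x : H, f (f x) = qadjoint T (T x) := by
      intro x
      simp only [f]
      rw [hinv', hBB, map_smul, map_smul, hinv]
    exact h1 x
  have hfB : ∀ x : H, f x = B x := fun x => DFunLike.congr_fun hCA x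
  have hBj : ∀ x : H, B (op j • x) = op j • B x := fun x => by
    rw [← hfB x]; simp only [f]; rw [hinv']
  have hBq : ∀ (q : ℍ[ℝ]) (x : H), B (op q • x) = op q • B x := by
    intro q x
    obtain ⟨z, w, rfl⟩ := hsplit q
    rw [MulOpposite.op_add, MulOpposite.op_mul, add_smul, add_smul, hBadd, hBz, mul_smul,
      mul_smul, hBj, hBz]
  let P : H →L[ℍ[ℝ]ᵐᵒᵖ] H :=
    ⟨⟨⟨B, hBadd⟩, fun q x => by obtain ⟨q⟩ := q; exact hBq q x⟩, hBcont⟩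
  have hPA : RightComplex.ofQ i P = A := rfl
  refine ⟨P, ⟨fun x => ?_, ContinuousLinearMap.ext fun x => hBB x⟩, fun Q ⟨hQ, hQQ⟩ => ?_⟩
  · have hs : qinner (B x) x = qinner x (B x) := by
      refine eq_of_proj_mul i fun a => ?_
      rw [← qinner_smul_right, ← qinner_smul_right, ← hBq, hBsymm]
    obtain ⟨r, hr, h⟩ := hBpos x
    refine ⟨r, hr, ?_⟩
    change qinner x (B x) = _
    have h1 : star (qinner x (B x)) = qinner x (B x) := by rw [star_qinner, hs]
    have h2 := Quaternion.star_eq_self.1 h1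
    rw [hs] at h
    rw [h2]
    congr 1
    exact congrArg Complex.re h
  · have h1 : RightComplex.ofQ i Q = A := by
      refine huniq _ (RightComplex.ofQ_nonneg i hQ) (ContinuousLinearMap.ext fun x => ?_)
      exact DFunLike.congr_fun hQQ x
    rw [← hPA] at h1
    exact ContinuousLinearMap.ext fun x => DFunLike.congr_fun h1 x

/-- The modulus `|T| = √(T* T)`: the unique positive operator whose square is `T* T`. -/
def qabs (T : H →L[ℍ[ℝ]ᵐᵒᵖ] H) : H →L[ℍ[ℝ]ᵐᵒᵖ] H := (existsUnique_qabs T).choose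

theorem qabs_spec (T : H →L[ℍ[ℝ]ᵐᵒᵖ] H) :
    QPositive (qabs T) ∧ qabs T * qabs T = qadjoint T * T :=
  (existsUnique_qabs T).choose_spec.1

end Abs

/-- The operator `x ↦ x r` for a real number `r`. -/
def realScalar : ℝ →+* (H →L[ℍ[ℝ]ᵐᵒᵖ] H) where
  toFun r :=
    { toFun := fun x => op (r : ℍ[ℝ]) • x
      map_add' := fun x y => smul_add _ x y
      map_smul' := fun a x => by
        rw [RingHom.id_apply, smul_smul, smul_smul]
        congr 1
        obtain ⟨a⟩ := a
        exact congrArg op (Quaternion.coe_commutes r a).symm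
      cont := continuous_op_smul _ }
  map_one' := ContinuousLinearMap.ext fun x => by
    change op ((1 : ℝ) : ℍ[ℝ]) • x = x
    simp
  map_mul' r s := ContinuousLinearMap.ext fun x => by
    change op ((r * s : ℝ) : ℍ[ℝ]) • x = op (r : ℍ[ℝ]) • op (s : ℍ[ℝ]) • x
    rw [smul_smul, ← MulOpposite.op_mul, mul_comm r s, Quaternion.coe_mul]
  map_zero' := ContinuousLinearMap.ext fun x => by
    change op ((0 : ℝ) : ℍ[ℝ]) • x = 0
    simp
  map_add' r s := ContinuousLinearMap.ext fun x => by
    change op ((r + s : ℝ) : ℍ[ℝ]) • x = op (r : ℍ[ℝ]) • x + op (s : ℍ[ℝ]) • x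
    rw [Quaternion.coe_add, MulOpposite.op_add, add_smul]

theorem realScalar_apply (r : ℝ) (x : H) : realScalar r x = op (r : ℍ[ℝ]) • x := rfl

theorem realScalar_comm (r : ℝ) (T : H →L[ℍ[ℝ]ᵐᵒᵖ] H) : T * realScalar r = realScalar r * T :=
  ContinuousLinearMap.ext fun x => map_smul T (op (r : ℍ[ℝ])) x

variable [CompleteSpace H]

variable (H) in
/-- An anti-selfadjoint and unitary operator on a quaternionic Hilbert space. -/
structure AntiSelfadjointUnitary where
  toOp : H →L[ℍ[ℝ]ᵐᵒᵖ] H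
  anti_selfadjoint : qadjoint toOp = -toOp
  adjoint_mul_self : qadjoint toOp * toOp = 1
  self_mul_adjoint : toOp * qadjoint toOp = 1

theorem AntiSelfadjointUnitary.apply_apply (J : AntiSelfadjointUnitary H) (x : H) :
    J.toOp (J.toOp x) = -x := by
  have h := DFunLike.congr_fun J.adjoint_mul_self x
  rw [J.anti_selfadjoint] at h
  exact neg_eq_iff_eq_neg.1 h

/-- The space `𝓑_J(H)` of bounded operators that commute with `J`. -/
def commutantOp (J : AntiSelfadjointUnitary H) : AddSubgroup (H →L[ℍ[ℝ]ᵐᵒᵖ] H) where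
  carrier := {T | T * J.toOp = J.toOp * T}
  zero_mem' := by simp
  add_mem' {S T} hS hT := by
    rw [Set.mem_ofPred_eq] at *
    rw [add_mul, mul_add, hS, hT]
  neg_mem' {T} hT := by
    rw [Set.mem_ofPred_eq] at *
    rw [neg_mul T J.toOp, mul_neg J.toOp T, hT]

theorem commutantOp_apply {J : AntiSelfadjointUnitary H} (T : commutantOp J) (x : H) :
    T.1 (J.toOp x) = J.toOp (T.1 x) := DFunLike.congr_fun T.2 x

/-- The operator `(a₀ + i a₁) T = a₀ T + a₁ J T`. -/
instance (J : AntiSelfadjointUnitary H) : SMul ℂ (commutantOp J) where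
  smul z T := ⟨realScalar z.re * T.1 + realScalar z.im * (J.toOp * T.1),
    ContinuousLinearMap.ext fun x => by
      change op (z.re : ℍ[ℝ]) • T.1 (J.toOp x) + op (z.im : ℍ[ℝ]) • J.toOp (T.1 (J.toOp x)) =
        J.toOp (op (z.re : ℍ[ℝ]) • T.1 x + op (z.im : ℍ[ℝ]) • J.toOp (T.1 x))
      rw [map_add, map_smul, map_smul, commutantOp_apply]⟩

theorem commutantOp_smul_apply {J : AntiSelfadjointUnitary H} (z : ℂ) (T : commutantOp J) (x : H) :
    (z • T).1 x = op (z.re : ℍ[ℝ]) • T.1 x + op (z.im : ℍ[ℝ]) • J.toOp (T.1 x) := rfl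

theorem commutantOp_ext {J : AntiSelfadjointUnitary H} {S T : commutantOp J}
    (h : ∀ x, S.1 x = T.1 x) : S = T := Subtype.ext (ContinuousLinearMap.ext h)

/-- `𝓑_J(H)` as a vector space over `ℂ_i ≅ ℂ`. -/
instance (J : AntiSelfadjointUnitary H) : Module ℂ (commutantOp J) where
  one_smul T := commutantOp_ext fun x => by rw [commutantOp_smul_apply]; simp
  mul_smul z w T := commutantOp_ext fun x => by
    simp only [commutantOp_smul_apply, map_add, map_smul, J.apply_apply, smul_add, smul_neg,
      smul_smul, ← MulOpposite.op_mul, ← Quaternion.coe_mul, Complex.mul_re, Complex.mul_im,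
      Quaternion.coe_add, Quaternion.coe_sub, MulOpposite.op_add, MulOpposite.op_sub, add_smul,
      sub_smul, mul_comm w.re, mul_comm w.im]
    abel
  smul_zero z := commutantOp_ext fun x => by
    rw [commutantOp_smul_apply]
    change _ • (0 : H) + _ • J.toOp (0 : H) = 0
    simp
  smul_add z S T := commutantOp_ext fun x => by
    change op (z.re : ℍ[ℝ]) • (S.1 x + T.1 x) + op (z.im : ℍ[ℝ]) • J.toOp (S.1 x + T.1 x) =
      (op (z.re : ℍ[ℝ]) • S.1 x + op (z.im : ℍ[ℝ]) • J.toOp (S.1 x)) +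
        (op (z.re : ℍ[ℝ]) • T.1 x + op (z.im : ℍ[ℝ]) • J.toOp (T.1 x))
    rw [map_add, smul_add, smul_add]
    abel
  add_smul z w T := commutantOp_ext fun x => by
    change (op ((z + w).re : ℍ[ℝ]) • T.1 x + op ((z + w).im : ℍ[ℝ]) • J.toOp (T.1 x)) =
      (op (z.re : ℍ[ℝ]) • T.1 x + op (z.im : ℍ[ℝ]) • J.toOp (T.1 x)) +
        (op (w.re : ℍ[ℝ]) • T.1 x + op (w.im : ℍ[ℝ]) • J.toOp (T.1 x))
    rw [Complex.add_re, Complex.add_im, Quaternion.coe_add, Quaternion.coe_add,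
      MulOpposite.op_add, MulOpposite.op_add, add_smul, add_smul]
    abel
  zero_smul T := commutantOp_ext fun x => by
    rw [commutantOp_smul_apply]
    change _ = (0 : H)
    simp

/-- The complex Hilbert space `H₊^{Ji} = {x | J x = x i}`. -/
def HPlus (J : AntiSelfadjointUnitary H) (i : ImaginaryUnit) : Submodule ℂ (RightComplex H i) where
  carrier := {x | RightComplex.ofQ i J.toOp x = op i.val • x}
  zero_mem' := by simp
  add_mem' {x y} hx hy := by
    rw [Set.mem_ofPred_eq] at *
    rw [map_add, hx, hy, smul_add]
  smul_mem' z x hx := by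
    rw [Set.mem_ofPred_eq] at *
    rw [map_smul, hx, RightComplex.smul_def, RightComplex.smul_def, smul_smul, smul_smul,
      ← MulOpposite.op_mul, ← MulOpposite.op_mul]
    congr 2
    simp [ImaginaryUnit.embed, mul_add, add_mul, mul_assoc, Quaternion.coe_commutes]

instance (J : AntiSelfadjointUnitary H) (i : ImaginaryUnit) : CompleteSpace (HPlus J i) := by
  have h : IsClosed (HPlus J i : Set (RightComplex H i)) :=
    isClosed_eq (RightComplex.ofQ i J.toOp).continuous (continuous_op_smul i.val)
  exact h.completeSpace_coe

/-- On `H₊^{Ji}` the quaternionic scalar product takes values in `ℂ_i`, and the complex scalar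
product is its restriction. -/
theorem HPlus.embed_inner {J : AntiSelfadjointUnitary H} {i : ImaginaryUnit} (x y : HPlus J i) :
    i.embed (inner ℂ x y) = qinner x.1 y.1 := by
  have hq : ∀ x y : H, qinner (J.toOp x) y = -qinner x (J.toOp y) := by
    intro x y
    have h := qadjoint_qinner J.toOp x y
    rw [J.anti_selfadjoint] at h
    have h' : qinner (-J.toOp x) y = -qinner (J.toOp x) y := by
      have h0 := qinner_smul_left (J.toOp x) y (-1)
      simpa using h0
    rw [← h]
    change _ = -qinner (-J.toOp x) y
    rw [h', neg_neg]
  have hx : ∀ x : HPlus J i, RightComplex.ofQ i J.toOp x.1 = op i.val • x.1 := fun x => x.2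
  have h1 : qinner (RightComplex.ofQ i J.toOp x.1) y.1 =
      -qinner x.1 (RightComplex.ofQ i J.toOp y.1) := hq x.1 y.1
  have hs : star i.val = -i.val := by ext <;> simp [i.re_eq_zero]
  rw [hx, hx, qinner_smul_left, qinner_smul_right, hs, neg_mul, neg_inj] at h1
  exact i.embed_proj h1.symm

/-- The restriction `T ↦ T|_{H₊^{Ji}}` of the operators that commute with `J`. -/
def resJ (J : AntiSelfadjointUnitary H) (i : ImaginaryUnit) :
    commutantOp J →ₗ[ℂ] (HPlus J i →L[ℂ] HPlus J i) where
  toFun T := (RightComplex.ofQ i T.1).restrict (p := HPlus J i) (q := HPlus J i) fun x hx => by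
    have h : ∀ x : H, J.toOp x = op i.val • x → J.toOp (T.1 x) = op i.val • T.1 x := by
      intro x hx
      rw [← commutantOp_apply, hx, map_smul]
    exact h x hx
  map_add' S T := rfl
  map_smul' z T := ContinuousLinearMap.ext fun x => Subtype.ext <| by
    have h : ∀ x : H, J.toOp x = op i.val • x →
        (z • T).1 x = op (i.embed z) • T.1 x := by
      intro x hx
      rw [commutantOp_smul_apply, ← commutantOp_apply, hx, map_smul, smul_smul,
        ← MulOpposite.op_mul, ← add_smul, ← MulOpposite.op_add, ← Quaternion.coe_commutes]
      rfl
    exact h x.1 x.2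

end Space

section SingularValues

universe u

/-- The decreasing enumeration (`n = 0, 1, 2, …`) of the positive numbers `μ`, each repeated
`mult μ` times, continued by zeros if it is finite: the `n`-th entry is the least `t ≥ 0` such
that at most `n` of these numbers, counted with multiplicity, are larger than `t`. -/
def decreasingEnum (mult : ℝ → Cardinal.{u}) (n : ℕ) : ℝ :=
  sInf {t : ℝ | 0 ≤ t ∧ Cardinal.sum (fun μ : Set.Ioi t => mult μ) ≤ n}

/-- The `ℓ^p`-(quasi)norm of a sequence, for `0 < p ≤ ∞`. -/
def lpQuasiNorm (p : ℝ≥0∞) (s : ℕ → ℝ) : ℝ :=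
  if p = ∞ then ⨆ n, |s n| else (∑' n, |s n| ^ p.toReal) ^ (1 / p.toReal)

section Complex

variable {K : Type u} [NormedAddCommGroup K] [InnerProductSpace ℂ K] [CompleteSpace K]

/-- The singular values of a (compact) operator on a complex Hilbert space: the eigenvalues of
`|T|` in decreasing order, repeated according to multiplicity. -/
def singularValue (T : K →L[ℂ] K) : ℕ → ℝ :=
  decreasingEnum fun μ =>
    Module.rank ℂ (Module.End.eigenspace (CFC.abs T : K →L[ℂ] K).toLinearMap (μ : ℂ))

variable (K) in
/-- The Schatten class `S_p(K)` of a complex Hilbert space. -/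
def schattenClass (p : ℝ≥0∞) : Set (K →L[ℂ] K) :=
  {T | IsCompactOperator T ∧ Memℓp (singularValue T) p}

/-- The Schatten `p`-(quasi)norm of an operator on a complex Hilbert space. -/
def schattenNorm (p : ℝ≥0∞) (T : K →L[ℂ] K) : ℝ := lpQuasiNorm p (singularValue T)

end Complex

section Quaternionic

variable {H : Type u} [NormedAddCommGroup H] [Module ℍ[ℝ]ᵐᵒᵖ H] [QuaternionicInnerProductSpace H]

/-- The eigenspace `{x | T x = x μ}` of a right linear operator for a real number `μ`. -/
def qEigenspace (T : H →L[ℍ[ℝ]ᵐᵒᵖ] H) (μ : ℝ) : Submodule ℍ[ℝ]ᵐᵒᵖ H :=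
  LinearMap.ker (T - realScalar μ).toLinearMap

theorem mem_qEigenspace (T : H →L[ℍ[ℝ]ᵐᵒᵖ] H) (μ : ℝ) (x : H) :
    x ∈ qEigenspace T μ ↔ T x = op (μ : ℍ[ℝ]) • x := by
  change T x - realScalar μ x = 0 ↔ _
  rw [sub_eq_zero, realScalar_apply]

variable [CompleteSpace H]

/-- The singular values of a (compact) quaternionic operator: the eigenvalues of `|T|` in
decreasing order, repeated according to multiplicity. -/
def qSingularValue (T : H →L[ℍ[ℝ]ᵐᵒᵖ] H) : ℕ → ℝ :=
  decreasingEnum fun μ => Module.rank ℍ[ℝ]ᵐᵒᵖ (qEigenspace (qabs T) μ)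

/-- The `(J, p)`-Schatten class `S_p(J)`. -/
def qSchattenClass (J : AntiSelfadjointUnitary H) (p : ℝ≥0∞) : Set (H →L[ℍ[ℝ]ᵐᵒᵖ] H) :=
  {T | IsCompactOperator T ∧ T * J.toOp = J.toOp * T ∧ Memℓp (qSingularValue T) p}

/-- The `p`-(quasi)norm of a quaternionic operator. -/
def qSchattenNorm (p : ℝ≥0∞) (T : H →L[ℍ[ℝ]ᵐᵒᵖ] H) : ℝ := lpQuasiNorm p (qSingularValue T)

end Quaternionic

end SingularValues

/-- `N` is a norm on the complex vector space `V`, and `V` is complete for it. -/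
def IsBanachNorm {V : Type*} [AddCommGroup V] [Module ℂ V] (N : V → ℝ) : Prop :=
  letI : Norm V := ⟨N⟩
  ∃ core : NormedSpace.Core ℂ V,
    letI : NormedAddCommGroup V := NormedAddCommGroup.ofCore core
    CompleteSpace V

end

noncomputable section

universe u

/-! ### Spectral decomposition of the modulus of a compact operator. -/

section SpectralDecomposition

open Module.End

variable {K : Type*} [NormedAddCommGroup K] [InnerProductSpace ℂ K] [CompleteSpace K]

/-! Choose an imaginary unit `j` with `ij = -ji`. Right multiplication by `j` exchanges the two
eigenspaces of `J`, so H = H₊ ⊕ H₊j. An operator commuting with `J` is determined by its restriction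
to H₊, and a bounded complex operator `S` on H₊ extends by T(a + bj) = Sa + (Sb)j
(`exists_extension`); `T` is compact exactly when `S` is. Since -J|T|J is again a positive square
root of T*T, uniqueness of the root shows that |T| commutes with `J` and restricts to |S|. For real
μ the eigenspace of |T| is E ⊕ Ej, with E the eigenspace of |S|, so a complex basis of E is a
quaternionic basis of it. Hence `T` and `S` have the same singular values (`singularValue_resJ`),
and everything reduces to a complex Hilbert space.

There the singular values of compact operators are Gelfand numbers
(`singularValue_le_iff_exists_submodule`), a description without |T|. It gives s_{m+n}(S+T) ≤ s_m(S)
+ s_n(T), hence the linearity of the class for every p > 0, and the continuity of each s_n in the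
operator norm. For p ≥ 1 the sum of s_n(T)^p is the largest value of ∑|⟨f_k, T e_k⟩|^p over
orthonormal families, so the triangle inequality is Minkowski's (`Lp_singularValue_add_le`).
Completeness follows from that of the bounded operators and a Fatou argument
(`mem_schattenClass_of_tendsto`). -/

theorem IsCompactOperator.of_norm_apply_eq {S T : K →L[ℂ] K} (h : ∀ x, ‖S x‖ = ‖T x‖)
    (hT : IsCompactOperator T) : IsCompactOperator S := by
  have hT' := (isCompactOperator_iff_isCompact_closure_image_closedBall
    (T : K →ₗ[ℂ] K) one_pos).1 hT
  refine (isCompactOperator_iff_isCompact_closure_image_closedBall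
    (S : K →ₗ[ℂ] K) one_pos).2 ?_
  refine isCompact_iff_totallyBounded_isComplete.2 ⟨TotallyBounded.closure ?_,
    isClosed_closure.isComplete⟩
  refine Metric.totallyBounded_iff.2 fun ε hε => ?_
  obtain ⟨t, htsub, htfin, hcover⟩ := Metric.finite_approx_of_totallyBounded
    (hT'.totallyBounded.subset subset_closure) ε hε
  -- Pull the finite net back to the ball and push it forward by `S`: distances between images agree
  -- for `S` and `T`.
  have hpre : ∀ y ∈ t, ∃ x, x ∈ Metric.closedBall (0 : K) 1 ∧ T x = y := fun y hy => htsub hy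
  choose! g hg hgT using hpre
  refine ⟨S ∘ g '' t, htfin.image _, ?_⟩
  rintro _ ⟨x, hx, rfl⟩
  obtain ⟨y, hy, hxy⟩ := Set.mem_iUnion₂.1 (hcover ⟨x, hx, rfl⟩)
  refine Set.mem_iUnion₂.2 ⟨S (g y), ⟨y, hy, rfl⟩, ?_⟩
  rw [← hgT y hy] at hxy
  rw [Metric.mem_ball, dist_eq_norm] at *
  change ‖T x - T (g y)‖ < ε at hxy
  change ‖S x - S (g y)‖ < ε
  rwa [← map_sub, h, map_sub]

theorem norm_abs_apply (T : K →L[ℂ] K) (x : K) : ‖(CFC.abs T : K →L[ℂ] K) x‖ = ‖T x‖ := by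
  have hA : (CFC.abs T : K →L[ℂ] K).IsPositive :=
    (ContinuousLinearMap.nonneg_iff_isPositive _).1 (CFC.abs_nonneg T)
  have h : inner ℂ ((CFC.abs T : K →L[ℂ] K) x) ((CFC.abs T : K →L[ℂ] K) x) =
      inner ℂ (T x) (T x) := by
    have h1 : inner ℂ ((CFC.abs T : K →L[ℂ] K) x) ((CFC.abs T : K →L[ℂ] K) x) =
        inner ℂ x ((CFC.abs T * CFC.abs T : K →L[ℂ] K) x) := hA.isSymmetric _ _
    rw [h1, CFC.abs_mul_abs]
    exact ContinuousLinearMap.adjoint_inner_right T x (T x)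
  rw [inner_self_eq_norm_sq_to_K, inner_self_eq_norm_sq_to_K] at h
  have h2 : ‖(CFC.abs T : K →L[ℂ] K) x‖ ^ 2 = ‖T x‖ ^ 2 := by exact_mod_cast h
  exact (sq_eq_sq₀ (norm_nonneg _) (norm_nonneg _)).1 h2

theorem abs_isSymmetric (T : K →L[ℂ] K) :
    ((CFC.abs T : K →L[ℂ] K) : K →ₗ[ℂ] K).IsSymmetric :=
  ((ContinuousLinearMap.nonneg_iff_isPositive _).1 (CFC.abs_nonneg T)).isSymmetric

/-- An orthonormal basis of eigenvectors of `|T|`, with its eigenvalues. -/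
structure ModulusEigenbasis (T : K →L[ℂ] K) (ι : Type*) where
  basis : HilbertBasis ι ℂ K
  val : ι → ℝ
  val_nonneg : ∀ i, 0 ≤ val i
  abs_apply : ∀ i, (CFC.abs T : K →L[ℂ] K) (basis i) = (val i : ℂ) • basis i
  singularValue_le_iff : ∀ (n : ℕ) {t : ℝ}, 0 ≤ t →
    (singularValue T n ≤ t ↔ {i | t < val i}.encard ≤ n)

/-- Symmetry makes eigenvalues real and positivity makes them nonnegative, so an eigenbasis can be
indexed by real eigenvalues. -/
theorem eigenspace_abs_eq_bot (T : K →L[ℂ] K) {c : ℂ} (hc : ∀ r : ℝ, 0 ≤ r → c ≠ r) :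
    eigenspace ((CFC.abs T : K →L[ℂ] K) : K →ₗ[ℂ] K) c = ⊥ := by
  by_contra hne
  have hev : HasEigenvalue ((CFC.abs T : K →L[ℂ] K) : K →ₗ[ℂ] K) c := hne
  have h1 := (abs_isSymmetric T).conj_eigenvalue_eq_self hev
  obtain ⟨r, rfl⟩ := Complex.conj_eq_iff_real.1 h1
  refine hc r (eigenvalue_nonneg_of_nonneg hev fun x => ?_) rfl
  have hA : (CFC.abs T : K →L[ℂ] K).IsPositive :=
    (ContinuousLinearMap.nonneg_iff_isPositive _).1 (CFC.abs_nonneg T)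
  exact hA.re_inner_nonneg_right x

/-- The singular values computed from a counting function. -/
theorem sInf_encard_le_iff {ι : Type*} (val : ι → ℝ) (n : ℕ) {t B : ℝ} (ht : 0 ≤ t) (hB0 : 0 ≤ B)
    (hB : ∀ i, val i ≤ B) :
    sInf {t : ℝ | 0 ≤ t ∧ {i | t < val i}.encard ≤ n} ≤ t ↔ {i | t < val i}.encard ≤ n := by
  have hbdd : BddBelow {t : ℝ | 0 ≤ t ∧ {i | t < val i}.encard ≤ n} := ⟨0, fun s hs => hs.1⟩
  have hne : {t : ℝ | 0 ≤ t ∧ {i | t < val i}.encard ≤ n}.Nonempty := by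
    refine ⟨B, hB0, ?_⟩
    have : {i | B < val i} = ∅ := Set.eq_empty_of_forall_notMem fun i hi => (hB i).not_gt hi
    simp [this]
  refine ⟨fun h => ?_, fun h => csInf_le hbdd ⟨ht, h⟩⟩
  by_contra! hlt
  -- Among n + 1 indices with values above `t`, let `a` have the least value. The infimum lies below
  -- `val a`, so some admissible `s` does too, yet all n + 1 values exceed `s`. In effect the
  -- infimum is attained.
  obtain ⟨u, hu, hucard⟩ := Set.exists_subset_encard_eq (Order.add_one_le_of_lt hlt)
  have hufin : u.Finite := Set.finite_of_encard_eq_coe (k := n + 1) (by simpa using hucard)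
  have hune : u.Nonempty := by
    rw [← Set.encard_ne_zero, hucard]; simp
  obtain ⟨a, ha, hmin⟩ := Set.exists_min_image u val hufin hune
  obtain ⟨s, hs, hsa⟩ := exists_lt_of_csInf_lt hne (h.trans_lt (hu ha))
  have h1 : u.encard ≤ n :=
    (Set.encard_le_encard fun i hi => hsa.trans_le (hmin i hi)).trans hs.2
  rw [hucard] at h1
  exact absurd h1 (by exact_mod_cast (Nat.lt_succ_self n).not_ge)

/-- Glue Hilbert bases of all eigenspaces of the compact operator |T|. The kernel is needed for
totality and may be infinite-dimensional, but counting only concerns eigenvalues above some t ≥ 0,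
whose eigenspaces are finite-dimensional, so that their ranks count basis vectors. -/
theorem exists_modulusEigenbasis {K : Type u} [NormedAddCommGroup K] [InnerProductSpace ℂ K]
    [CompleteSpace K] {T : K →L[ℂ] K} (hT : IsCompactOperator T) :
    ∃ ι : Type u, Nonempty (ModulusEigenbasis T ι) := by
  set A : K →L[ℂ] K := CFC.abs T with hA
  have hAc : IsCompactOperator A := hT.of_norm_apply_eq (norm_abs_apply T)
  have hsymm := abs_isSymmetric T
  let E : ℝ → Submodule ℂ K := fun c => eigenspace (A : K →ₗ[ℂ] K) (c : ℂ)
  have hEc : ∀ c, CompleteSpace (E c) := fun c => by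
    have h : IsClosed (E c : Set K) := by
      have h2 : (E c : Set K) = {x | A x = (c : ℂ) • x} := by
        ext x; exact mem_eigenspace_iff
      rw [h2]
      exact isClosed_eq A.continuous (continuous_const_smul _)
    exact h.completeSpace_coe
  choose w b hb using fun c => exists_hilbertBasis ℂ (E c)
  have hfam : OrthogonalFamily ℂ (fun c => E c) fun c => (E c).subtypeₗᵢ :=
    hsymm.orthogonalFamily_eigenspaces.comp Complex.ofReal_injective
  let v : (Σ c, w c) → K := fun a => (b a.1 a.2 : E a.1)
  have hv : Orthonormal ℂ v := hfam.orthonormal_sigma_orthonormal fun c => (b c).orthonormal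
  have hspan : (Submodule.span ℂ (Set.range v))ᗮ = ⊥ := by
    rw [eq_bot_iff, ← ContinuousLinearMap.orthogonalComplement_iSup_eigenspaces_eq_bot hAc hsymm,
      ← Submodule.iInf_orthogonal]
    intro x hx
    rw [Submodule.mem_iInf]
    intro c
    by_cases hc : ∃ r : ℝ, 0 ≤ r ∧ c = r
    · obtain ⟨r, -, rfl⟩ := hc
      intro y hy
      -- The orthogonal complement of `x` is closed and contains the basis of `E r`, hence all of `E
      -- r`.
      have h1 : Submodule.span ℂ (Set.range (b r)) ≤ LinearMap.ker
          ((innerSL ℂ x : K →L[ℂ] ℂ).comp (E r).subtypeL).toLinearMap := by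
        rw [Submodule.span_le]
        rintro _ ⟨k, rfl⟩
        exact inner_eq_zero_symm.1 (hx _ (Submodule.subset_span ⟨⟨r, k⟩, rfl⟩))
      have h2 := Submodule.topologicalClosure_minimal _ h1
        (ContinuousLinearMap.isClosed_ker ((innerSL ℂ x : K →L[ℂ] ℂ).comp (E r).subtypeL))
      rw [(b r).dense_span] at h2
      exact inner_eq_zero_symm.1 (h2 (Submodule.mem_top (x := (⟨y, hy⟩ : E r))))
    · push Not at hc
      rw [eigenspace_abs_eq_bot T hc]
      simp
  have hle : ∀ i : Σ c, w c, A (v i) = (i.1 : ℂ) • v i := fun i =>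
    mem_eigenspace_iff.1 (b i.1 i.2).2
  have hnorm : ∀ i : Σ c, w c, |i.1| ≤ ‖A‖ := fun i => by
    have h1 := A.le_opNorm (v i)
    rw [hle, norm_smul, hv.1 i] at h1
    simpa using h1
  have hnonneg : ∀ i : Σ c, w c, 0 ≤ i.1 := fun i => by
    by_contra hlt
    have h1 := eigenspace_abs_eq_bot T (c := i.1) fun r hr h => hlt (by
      rw [Complex.ofReal_inj.1 h]; exact hr)
    have h2 : v i ∈ eigenspace (A : K →ₗ[ℂ] K) (i.1 : ℂ) := (b i.1 i.2).2
    rw [h1, Submodule.mem_bot] at h2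
    have h3 := hv.1 i
    simp [h2] at h3
  have hrank : ∀ c : ℝ, 0 < c → Module.rank ℂ (E c) = Cardinal.mk (w c) := fun c hc => by
    have : FiniteDimensional ℂ (E c) :=
      ContinuousLinearMap.finite_dimensional_eigenspace hAc c (by exact_mod_cast hc.ne')
    have : Finite (w c) := (b c).orthonormal.linearIndependent.finite
    have := Fintype.ofFinite (w c)
    exact (b c).toOrthonormalBasis.toBasis.mk_eq_rank''.symm
  refine ⟨Σ c, w c, ⟨⟨HilbertBasis.mkOfOrthogonalEqBot hv hspan, fun i => i.1, hnonneg, fun i => ?_,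
    fun n t ht => ?_⟩⟩⟩
  · rw [HilbertBasis.coe_mkOfOrthogonalEqBot]
    exact hle i
  · rw [← sInf_encard_le_iff (fun i : Σ c, w c => i.1) n ht (norm_nonneg A)
      fun i => (le_abs_self _).trans (hnorm i)]
    have hset : {t : ℝ | 0 ≤ t ∧ Cardinal.sum (fun μ : Set.Ioi t =>
        Module.rank ℂ (eigenspace (A : K →ₗ[ℂ] K) ((μ : ℝ) : ℂ))) ≤ n} =
        {t : ℝ | 0 ≤ t ∧ {i : Σ c, w c | t < i.1}.encard ≤ n} := by
      ext s
      refine and_congr_right fun hs => ?_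
      have h1 : Cardinal.sum (fun μ : Set.Ioi s =>
          Module.rank ℂ (eigenspace (A : K →ₗ[ℂ] K) ((μ : ℝ) : ℂ))) =
          Cardinal.mk {i : Σ c, w c | s < i.1} := by
        rw [show (fun μ : Set.Ioi s => Module.rank ℂ (eigenspace (A : K →ₗ[ℂ] K) ((μ : ℝ) : ℂ))) =
          fun μ : Set.Ioi s => Cardinal.mk (w μ) from funext fun μ => hrank μ (hs.trans_lt μ.2),
          ← Cardinal.mk_sigma]
        exact Cardinal.mk_congr
          ⟨fun a => ⟨⟨a.1, a.2⟩, a.1.2⟩, fun a => ⟨⟨a.1.1, a.2⟩, a.1.2⟩, fun _ => rfl, fun _ => rfl⟩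
      rw [h1, ← Cardinal.toENat_le_natCast]
      rfl
    exact (congrArg (sInf · ≤ t) hset).to_iff

end SpectralDecomposition

/-! ### Counting eigenvalues by subspaces of small dimension. -/

section GelfandNumbers

variable {K : Type*} [NormedAddCommGroup K] [InnerProductSpace ℂ K]

theorem HilbertBasis.hasSum_norm_inner_sq {ι : Type*} (b : HilbertBasis ι ℂ K) (x : K) :
    HasSum (fun i => ‖inner ℂ (b i) x‖ ^ 2) (‖x‖ ^ 2) := by
  have h := (b.hasSum_inner_mul_inner x x).mapL Complex.reCLM
  convert! h using 1
  · funext i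
    rw [← inner_conj_symm x (b i), Complex.conj_mul']
    simp only [Complex.reCLM_apply]
    exact_mod_cast (Complex.ofReal_re _).symm
  · rw [inner_self_eq_norm_sq_to_K]
    simp only [Complex.reCLM_apply]
    exact_mod_cast (Complex.ofReal_re _).symm

variable [CompleteSpace K]

namespace ModulusEigenbasis

variable {T : K →L[ℂ] K} {ι : Type*} (D : ModulusEigenbasis T ι)

theorem inner_basis_abs (i : ι) (x : K) :
    inner ℂ (D.basis i) ((CFC.abs T : K →L[ℂ] K) x) = D.val i * inner ℂ (D.basis i) x := by
  have h : inner ℂ ((CFC.abs T : K →L[ℂ] K) (D.basis i)) x =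
    inner ℂ (D.basis i) ((CFC.abs T : K →L[ℂ] K) x) := abs_isSymmetric T _ _
  rw [← h, D.abs_apply, inner_smul_left, Complex.conj_ofReal]

theorem hasSum_norm_apply_sq (x : K) :
    HasSum (fun i => D.val i ^ 2 * ‖inner ℂ (D.basis i) x‖ ^ 2) (‖T x‖ ^ 2) := by
  have h := D.basis.hasSum_norm_inner_sq ((CFC.abs T : K →L[ℂ] K) x)
  rw [norm_abs_apply] at h
  convert! h using 2 with i
  rw [D.inner_basis_abs, norm_mul, mul_pow, Complex.norm_real, Real.norm_eq_abs, sq_abs]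

/-- Forward, `F` is spanned by the eigenvectors with value above `t`. Backward, n + 1 such
eigenvectors would span a `W` of dimension larger than that of `F`, so `W` meets Fᗮ in some x ≠ 0;
but ‖Tx‖ ≥ (least value)·‖x‖ > t‖x‖ on `W`. -/
theorem encard_le_iff_exists_submodule (n : ℕ) {t : ℝ} (ht : 0 ≤ t) :
    {i | t < D.val i}.encard ≤ n ↔ ∃ F : Submodule ℂ K, FiniteDimensional ℂ F ∧
      Module.finrank ℂ F ≤ n ∧ ∀ x ∈ Fᗮ, ‖T x‖ ≤ t * ‖x‖ := by
  constructor
  · intro h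
    have hfin : {i | t < D.val i}.Finite := (Set.encard_le_coe_iff.1 h).1
    have : Fintype {i | t < D.val i} := hfin.fintype
    refine ⟨Submodule.span ℂ (Set.range fun i : {i | t < D.val i} => D.basis i),
      FiniteDimensional.span_of_finite ℂ (Set.finite_range _), ?_, fun x hx => ?_⟩
    · refine (finrank_range_le_card _).trans ?_
      rw [← Set.toFinset_card]
      rw [← Set.coe_toFinset {i | t < D.val i}, Set.encard_coe_eq_coe_finsetCard] at h
      exact_mod_cast h
    · refine abs_le_of_sq_le_sq' ?_ (by positivity) |>.2
      rw [mul_pow]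
      refine hasSum_le (fun i => ?_) (D.hasSum_norm_apply_sq x)
        ((D.basis.hasSum_norm_inner_sq x).mul_left (t ^ 2))
      by_cases hi : t < D.val i
      · rw [hx _ (Submodule.subset_span ⟨⟨i, hi⟩, rfl⟩)]
        simp
      · have := D.val_nonneg i
        gcongr
        exact not_lt.1 hi
  · rintro ⟨F, hF, hFn, hFT⟩
    by_contra! hlt
    obtain ⟨u, hu, hucard⟩ := Set.exists_subset_encard_eq (Order.add_one_le_of_lt hlt)
    have hufin : u.Finite := Set.finite_of_encard_eq_coe (k := n + 1) (by simpa using hucard)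
    have hune : u.Nonempty := by
      rw [← Set.encard_ne_zero, hucard]; simp
    obtain ⟨a, ha, hmin⟩ := Set.exists_min_image u D.val hufin hune
    have : Fintype u := hufin.fintype
    let W : Submodule ℂ K := Submodule.span ℂ (Set.range fun i : u => D.basis i)
    have hW : FiniteDimensional ℂ W := FiniteDimensional.span_of_finite ℂ (Set.finite_range _)
    have hWrank : Module.finrank ℂ W = n + 1 := by
      have h1 := finrank_span_eq_card
        (D.basis.orthonormal.linearIndependent.comp ((↑) : u → ι) Subtype.val_injective)
      rw [← Set.toFinset_card] at h1
      rw [← Set.coe_toFinset u, Set.encard_coe_eq_coe_finsetCard] at hucard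
      exact h1.trans (by exact_mod_cast hucard)
    have hker := LinearMap.ker_ne_bot_of_finrank_lt
      (f := F.orthogonalProjectionOnto.toLinearMap ∘ₗ W.subtype) (by omega)
    obtain ⟨⟨x, hxW⟩, hxker, hx0⟩ := Submodule.exists_mem_ne_zero_of_ne_bot hker
    have hxF : x ∈ Fᗮ := Submodule.orthogonalProjectionOnto_eq_zero_iff.1 hxker
    have hx0' : x ≠ 0 := fun h => hx0 (Subtype.ext h)
    have hxu : ∀ i ∉ u, inner ℂ (D.basis i) x = 0 := by
      intro i hi
      have h1 : W ≤ LinearMap.ker (innerSL ℂ (D.basis i)).toLinearMap := by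
        rw [Submodule.span_le]
        rintro _ ⟨k, rfl⟩
        refine D.basis.orthonormal.2 fun h => hi ?_
        rw [h]; exact k.2
      exact h1 hxW
    have h2 : D.val a ^ 2 * ‖x‖ ^ 2 ≤ ‖T x‖ ^ 2 := by
      refine hasSum_le (fun i => ?_) ((D.basis.hasSum_norm_inner_sq x).mul_left (D.val a ^ 2))
        (D.hasSum_norm_apply_sq x)
      by_cases hi : i ∈ u
      · have := D.val_nonneg a
        gcongr
        exact hmin i hi
      · simp [hxu i hi]
    have h3 : t * ‖x‖ < D.val a * ‖x‖ := by
      have := norm_pos_iff.2 hx0'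
      gcongr
      exact hu ha
    rw [← mul_pow] at h2
    have h4 := abs_le_of_sq_le_sq' h2 (norm_nonneg _) |>.2
    exact absurd (h4.trans (hFT x hxF)) h3.not_ge

end ModulusEigenbasis

end GelfandNumbers

/-! ### Inequalities for singular values of compact operators. -/

section SingularValueInequalities

variable {K : Type u} [NormedAddCommGroup K] [InnerProductSpace ℂ K] [CompleteSpace K]

theorem singularValue_nonneg (T : K →L[ℂ] K) (n : ℕ) : 0 ≤ singularValue T n :=
  Real.sInf_nonneg fun _ h => h.1

/-- Singular values of compact operators are Gelfand numbers. -/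
theorem singularValue_le_iff_exists_submodule {T : K →L[ℂ] K} (hT : IsCompactOperator T) (n : ℕ)
    {t : ℝ} (ht : 0 ≤ t) :
    singularValue T n ≤ t ↔ ∃ F : Submodule ℂ K, FiniteDimensional ℂ F ∧
      Module.finrank ℂ F ≤ n ∧ ∀ x ∈ Fᗮ, ‖T x‖ ≤ t * ‖x‖ := by
  obtain ⟨ι, ⟨D⟩⟩ := exists_modulusEigenbasis hT
  rw [D.singularValue_le_iff n ht, D.encard_le_iff_exists_submodule n ht]

theorem singularValue_antitone {T : K →L[ℂ] K} (hT : IsCompactOperator T) :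
    Antitone (singularValue T) := by
  intro m n hmn
  rw [singularValue_le_iff_exists_submodule hT n (singularValue_nonneg T m)]
  obtain ⟨F, hF, hFm, h⟩ :=
    (singularValue_le_iff_exists_submodule hT m (singularValue_nonneg T m)).1 le_rfl
  exact ⟨F, hF, hFm.trans hmn, h⟩

/-- If `F` and `G` witness the two bounds, then `F ⊔ G` witnesses their sum: dimensions add, and its
complement lies in both complements. -/
theorem singularValue_add_le {S T : K →L[ℂ] K} (hS : IsCompactOperator S)
    (hT : IsCompactOperator T) (m n : ℕ) :
    singularValue (S + T) (m + n) ≤ singularValue S m + singularValue T n := by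
  have hs := singularValue_nonneg S m
  have ht := singularValue_nonneg T n
  obtain ⟨F, hF, hFm, hFS⟩ := (singularValue_le_iff_exists_submodule hS m hs).1 le_rfl
  obtain ⟨G, hG, hGn, hGT⟩ := (singularValue_le_iff_exists_submodule hT n ht).1 le_rfl
  refine (singularValue_le_iff_exists_submodule (hS.add hT) (m + n) (add_nonneg hs ht)).2
    ⟨F ⊔ G, inferInstance, (Submodule.finrank_add_le_finrank_add_finrank F G).trans (by omega),
      fun x hx => ?_⟩
  rw [add_mul]
  exact (norm_add_le (S x) (T x)).trans (add_le_add
    (hFS x (Submodule.orthogonal_le le_sup_left hx))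
    (hGT x (Submodule.orthogonal_le le_sup_right hx)))

theorem singularValue_zero_eq_norm {T : K →L[ℂ] K} (hT : IsCompactOperator T) :
    singularValue T 0 = ‖T‖ := by
  refine le_antisymm ?_ ?_
  · rw [singularValue_le_iff_exists_submodule hT 0 (norm_nonneg T)]
    exact ⟨⊥, inferInstance, by simp, fun x _ => T.le_opNorm x⟩
  · obtain ⟨F, hF, hF0, h⟩ :=
      (singularValue_le_iff_exists_submodule hT 0 (singularValue_nonneg T 0)).1 le_rfl
    rw [Nat.le_zero, Submodule.finrank_eq_zero] at hF0
    subst hF0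
    exact T.opNorm_le_bound (singularValue_nonneg T 0) fun x => h x (by simp)

theorem singularValue_le_norm {T : K →L[ℂ] K} (hT : IsCompactOperator T) (n : ℕ) :
    singularValue T n ≤ ‖T‖ :=
  (singularValue_antitone hT n.zero_le).trans (singularValue_zero_eq_norm hT).le

theorem singularValue_smul_le {T : K →L[ℂ] K} (hT : IsCompactOperator T) (z : ℂ) (n : ℕ) :
    singularValue (z • T) n ≤ ‖z‖ * singularValue T n := by
  have h0 := singularValue_nonneg T n
  obtain ⟨F, hF, hFn, h⟩ := (singularValue_le_iff_exists_submodule hT n h0).1 le_rfl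
  refine (singularValue_le_iff_exists_submodule (hT.smul z) n (by positivity)).2
    ⟨F, hF, hFn, fun x hx => ?_⟩
  change ‖z • T x‖ ≤ _
  rw [norm_smul, mul_assoc]
  exact mul_le_mul_of_nonneg_left (h x hx) (norm_nonneg z)

theorem singularValue_smul {T : K →L[ℂ] K} (hT : IsCompactOperator T) (z : ℂ) (n : ℕ) :
    singularValue (z • T) n = ‖z‖ * singularValue T n := by
  refine le_antisymm (singularValue_smul_le hT z n) ?_
  rcases eq_or_ne z 0 with rfl | hz
  · simpa using singularValue_nonneg _ n
  · have h := singularValue_smul_le (T := z • T) (hT.smul z) z⁻¹ n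
    rw [smul_smul, inv_mul_cancel₀ hz, one_smul, norm_inv] at h
    rwa [← le_inv_mul_iff₀ (norm_pos_iff.2 hz)]

/-- Write S = T + (S - T) and use the index `n + 0`, where s₀(S - T) is the operator norm. -/
theorem abs_singularValue_sub_le {S T : K →L[ℂ] K} (hS : IsCompactOperator S)
    (hT : IsCompactOperator T) (n : ℕ) :
    |singularValue S n - singularValue T n| ≤ ‖S - T‖ := by
  have key : ∀ {S T : K →L[ℂ] K}, IsCompactOperator S → IsCompactOperator T →
      singularValue S n ≤ singularValue T n + ‖S - T‖ := by
    intro S T hS hT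
    have h := singularValue_add_le (S := T) (T := S - T) hT (hS.sub hT) n 0
    rwa [add_sub_cancel, add_zero, singularValue_zero_eq_norm (T := S - T) (hS.sub hT)] at h
  rw [abs_le]
  have h1 := key hS hT
  have h2 := key hT hS
  rw [norm_sub_rev] at h2
  constructor <;> linarith

end SingularValueInequalities

/-! ### Inequalities of Jensen, Minkowski and Bessel with values in [0, ∞]. -/

section LpInequalities

theorem ENNReal.rpow_tsum_mul_le_tsum_mul_rpow {ι : Type*} (w z : ι → ℝ≥0∞) (hw : ∑' i, w i ≤ 1)
    {p : ℝ} (hp : 1 ≤ p) : (∑' i, w i * z i) ^ p ≤ ∑' i, w i * z i ^ p := by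
  have hp0 : 0 < p := by linarith
  rw [← ENNReal.le_rpow_inv_iff hp0, ENNReal.tsum_eq_iSup_sum]
  refine iSup_le fun s => ?_
  rw [ENNReal.le_rpow_inv_iff hp0]
  refine le_trans ?_ (ENNReal.sum_le_tsum s)
  have hs : ∑ i ∈ s, w i ≤ 1 := (ENNReal.sum_le_tsum s).trans hw
  -- The missing mass 1 - ∑ w goes to an extra point with value 0, which turns the weights into a
  -- probability.
  have h := ENNReal.rpow_arith_mean_le_arith_mean_rpow s.insertNone
    (fun i => i.elim (1 - ∑ i ∈ s, w i) w) (fun i => i.elim 0 z)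
    (by simp [Finset.sum_insertNone, tsub_add_cancel_of_le hs]) hp
  simpa [Finset.sum_insertNone, ENNReal.zero_rpow_of_pos hp0] using h

theorem ENNReal.Lp_add_le_tsum {ι : Type*} (f g : ι → ℝ≥0∞) {p : ℝ} (hp : 1 ≤ p) :
    (∑' i, (f i + g i) ^ p) ^ (1 / p) ≤ (∑' i, f i ^ p) ^ (1 / p) + (∑' i, g i ^ p) ^ (1 / p) := by
  have hp0 : 0 < p := by linarith
  rw [one_div, ENNReal.rpow_inv_le_iff hp0, ENNReal.tsum_eq_iSup_sum]
  refine iSup_le fun s => ?_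
  rw [← ENNReal.rpow_inv_le_iff hp0, ← one_div]
  refine (ENNReal.Lp_add_le s f g hp).trans ?_
  gcongr <;> exact ENNReal.sum_le_tsum s

theorem Orthonormal.tsum_enorm_inner_sq_le {E ι : Type*} [NormedAddCommGroup E]
    [InnerProductSpace ℂ E] {v : ι → E} (hv : Orthonormal ℂ v) (x : E) :
    ∑' i, ‖inner ℂ (v i) x‖ₑ ^ 2 ≤ ‖x‖ₑ ^ 2 := by
  rw [ENNReal.tsum_eq_iSup_sum]
  refine iSup_le fun s => ?_
  simp_rw [← ofReal_norm]
  rw [← ENNReal.ofReal_pow (norm_nonneg _)]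
  simp_rw [← ENNReal.ofReal_pow (norm_nonneg _)]
  rw [← ENNReal.ofReal_sum_of_nonneg fun _ _ => by positivity]
  exact ENNReal.ofReal_le_ofReal (hv.sum_inner_products_le x)

/-- The sum of the `p`-th powers of a nonnegative family depends only on its counting function. -/
theorem tsum_ofReal_rpow_congr {ι κ : Type*} {f : ι → ℝ} {g : κ → ℝ} (hf : ∀ i, 0 ≤ f i)
    (hg : ∀ k, 0 ≤ g k) (h : ∀ t, 0 < t → {i | t < f i}.encard = {k | t < g k}.encard)
    {p : ℝ} (hp : 0 < p) :
    ∑' i, ENNReal.ofReal (f i ^ p) = ∑' k, ENNReal.ofReal (g k ^ p) := by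
  let _ : MeasurableSpace ι := ⊤
  let _ : MeasurableSpace κ := ⊤
  -- Layer-cake formula for the counting measures: only the sizes of superlevel sets enter.
  rw [← MeasureTheory.lintegral_count, ← MeasureTheory.lintegral_count,
    MeasureTheory.lintegral_rpow_eq_lintegral_meas_lt_mul _ (.of_forall hf)
      (measurable_from_top.aemeasurable) hp,
    MeasureTheory.lintegral_rpow_eq_lintegral_meas_lt_mul _ (.of_forall hg)
      (measurable_from_top.aemeasurable) hp]
  congr 1
  refine MeasureTheory.setLIntegral_congr_fun measurableSet_Ioi fun t ht => ?_
  simp only [MeasureTheory.Measure.count_apply MeasurableSpace.measurableSet_top, h t ht]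

theorem encard_setOf_natCast_lt (N : ℕ∞) : {n : ℕ | (n : ℕ∞) < N}.encard = N := by
  induction N using ENat.recTopCoe with
  | top => simp
  | coe m =>
    have : {n : ℕ | (n : ℕ∞) < m} = Finset.range m := by ext; simp
    rw [this, Set.encard_coe_eq_coe_finsetCard, Finset.card_range]

end LpInequalities

/-! ### Variational description of the Schatten norm and its triangle inequality. -/

section SchattenTriangle

namespace ModulusEigenbasis

variable {K : Type*} [NormedAddCommGroup K] [InnerProductSpace ℂ K] [CompleteSpace K]
  {T : K →L[ℂ] K} {ι : Type*} (D : ModulusEigenbasis T ι)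

/-- The counting functions agree: with N(t) the number of `val i` above `t`, one has t < s_n iff n <
N(t), and exactly N(t) indices n = 0, 1, … satisfy this. -/
theorem tsum_ofReal_singularValue_rpow {p : ℝ} (hp : 0 < p) :
    ∑' n, ENNReal.ofReal (singularValue T n ^ p) = ∑' i, ENNReal.ofReal (D.val i ^ p) := by
  refine tsum_ofReal_rpow_congr (singularValue_nonneg T) D.val_nonneg (fun t ht => ?_) hp
  rw [← encard_setOf_natCast_lt {i | t < D.val i}.encard]
  congr 1
  ext n
  exact not_iff_not.1 (by simpa using D.singularValue_le_iff n ht.le)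

/-- The left singular vectors (zero where the singular value vanishes). -/
def leftVector (i : ι) : K := (D.val i : ℂ)⁻¹ • T (D.basis i)

theorem norm_apply_basis (i : ι) : ‖T (D.basis i)‖ = D.val i := by
  rw [← norm_abs_apply, D.abs_apply, norm_smul, D.basis.orthonormal.1 i, mul_one, Complex.norm_real,
    Real.norm_of_nonneg (D.val_nonneg i)]

theorem apply_basis (i : ι) : T (D.basis i) = (D.val i : ℂ) • D.leftVector i := by
  by_cases h : D.val i = 0
  · rw [h, Complex.ofReal_zero, zero_smul, ← norm_eq_zero, D.norm_apply_basis, h]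
  · rw [leftVector, smul_smul, mul_inv_cancel₀ (by exact_mod_cast h), one_smul]

/-- The vectors T e_i are orthogonal since ⟨T e_i, T e_j⟩ = ⟨e_i, |T|² e_j⟩, and ‖T e_i‖ is the
eigenvalue. -/
theorem orthonormal_leftVector :
    Orthonormal ℂ fun i : {i // D.val i ≠ 0} => D.leftVector i := by
  constructor
  · intro i
    change ‖(D.val i : ℂ)⁻¹ • T (D.basis i)‖ = 1
    rw [norm_smul, D.norm_apply_basis, norm_inv, Complex.norm_real,
      Real.norm_of_nonneg (D.val_nonneg i), inv_mul_cancel₀ i.2]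
  · intro i j hij
    have h1 : inner ℂ (T (D.basis i)) (T (D.basis j)) = 0 := by
      rw [← ContinuousLinearMap.adjoint_inner_right]
      change inner ℂ (D.basis i) ((star T * T) (D.basis j)) = 0
      rw [← CFC.abs_mul_abs]
      change inner ℂ (D.basis i) ((CFC.abs T : K →L[ℂ] K) ((CFC.abs T : K →L[ℂ] K) _)) = 0
      rw [D.inner_basis_abs, D.inner_basis_abs,
        D.basis.orthonormal.2 fun h => hij (Subtype.ext h), mul_zero, mul_zero]
    simp only [leftVector, inner_smul_left, inner_smul_right, h1, mul_zero]

theorem tsum_enorm_inner_leftVector_sq_le (x : K) :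
    ∑' i, ‖inner ℂ x (D.leftVector i)‖ₑ ^ 2 ≤ ‖x‖ₑ ^ 2 := by
  have h := D.orthonormal_leftVector.tsum_enorm_inner_sq_le x
  rw [← tsum_subtype_eq_of_support_subset (s := {i | D.val i ≠ 0})]
  · refine le_of_eq_of_le (tsum_congr fun i => ?_) h
    rw [← ofReal_norm, ← ofReal_norm, norm_inner_symm]
  · intro i hi h0
    refine hi ?_
    simp [leftVector, h0]

theorem enorm_leftVector_le (i : ι) : ‖D.leftVector i‖ₑ ≤ 1 := by
  by_cases h : D.val i = 0
  · simp [leftVector, h]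
  · rw [← ofReal_norm, D.orthonormal_leftVector.1 ⟨i, h⟩, ENNReal.ofReal_one]

theorem inner_leftVector_apply_basis (i : {i // D.val i ≠ 0}) :
    inner ℂ (D.leftVector i) (T (D.basis i)) = D.val i := by
  rw [D.apply_basis, inner_smul_right, inner_self_eq_norm_sq_to_K, D.orthonormal_leftVector.1 i]
  simp

/-- Expand T e = ∑ s_i ⟨e_i, e⟩ u_i and apply |ab| ≤ (a² + b²)/2. The squares are what Bessel's
inequality can sum. -/
theorem enorm_inner_apply_le (e f : K) :
    ‖inner ℂ f (T e)‖ₑ ≤ ∑' i, ((‖inner ℂ (D.basis i) e‖ₑ ^ 2 +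
      ‖inner ℂ f (D.leftVector i)‖ₑ ^ 2) / 2) * ENNReal.ofReal (D.val i) := by
  have h := ((D.basis.hasSum_repr e).mapL T).mapL (innerSL ℂ f)
  rw [← innerSL_apply_apply, ← h.tsum_eq]
  refine enorm_tsum_le_tsum_enorm.trans (ENNReal.tsum_le_tsum fun i => ?_)
  rw [map_smul, map_smul, D.apply_basis, map_smul, innerSL_apply_apply, D.basis.repr_apply_apply]
  simp only [smul_eq_mul, enorm_mul]
  rw [← mul_assoc, mul_right_comm]
  have h1 : ‖(D.val i : ℂ)‖ₑ = ENNReal.ofReal (D.val i) := by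
    rw [← ofReal_norm, Complex.norm_real, Real.norm_of_nonneg (D.val_nonneg i)]
  rw [h1]
  gcongr
  rw [ENNReal.le_div_iff_mul_le (by simp) (by simp)]
  simp_rw [← ofReal_norm]
  rw [← ENNReal.ofReal_mul (norm_nonneg _), ← ENNReal.ofReal_pow (norm_nonneg _),
    ← ENNReal.ofReal_pow (norm_nonneg _), ← ENNReal.ofReal_add (by positivity) (by positivity),
    ← ENNReal.ofReal_ofNat 2, ← ENNReal.ofReal_mul (by positivity)]
  refine ENNReal.ofReal_le_ofReal ?_
  nlinarith [sq_nonneg (‖inner ℂ (D.basis i) e‖ - ‖inner ℂ f (D.leftVector i)‖)]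

/-- The weights `w k i` are doubly substochastic by Bessel's inequality. Row sums ≤ 1 allow Jensen's
inequality for each `k`; after exchanging the sums, column sums ≤ 1 remove the weights. -/
theorem tsum_enorm_inner_apply_rpow_le {κ : Type*} {e f : κ → K} (he : Orthonormal ℂ e)
    (hf : Orthonormal ℂ f) {p : ℝ} (hp : 1 ≤ p) :
    ∑' k, ‖inner ℂ (f k) (T (e k))‖ₑ ^ p ≤ ∑' i, ENNReal.ofReal (D.val i) ^ p := by
  have hhalf : ∀ {a b : ℝ≥0∞}, a ≤ 1 → b ≤ 1 → (a + b) / 2 ≤ 1 := by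
    intro a b ha hb
    rw [ENNReal.div_le_iff (by simp) (by simp), one_mul, ← one_add_one_eq_two]
    exact add_le_add ha hb
  have hnorm : ∀ {x : K}, ‖x‖ = 1 → ‖x‖ₑ ^ 2 ≤ 1 := by
    intro x hx
    rw [← ofReal_norm, hx]; simp
  let w : κ → ι → ℝ≥0∞ := fun k i => (‖inner ℂ (D.basis i) (e k)‖ₑ ^ 2 +
      ‖inner ℂ (f k) (D.leftVector i)‖ₑ ^ 2) / 2
  have hrow : ∀ k, ∑' i, w k i ≤ 1 := by
    intro k
    simp only [w, div_eq_mul_inv]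
    rw [ENNReal.tsum_mul_right, ENNReal.tsum_add, ← div_eq_mul_inv]
    exact hhalf ((D.basis.orthonormal.tsum_enorm_inner_sq_le (e k)).trans (hnorm (he.1 k)))
      ((D.tsum_enorm_inner_leftVector_sq_le (f k)).trans (hnorm (hf.1 k)))
  have hcol : ∀ i, ∑' k, w k i ≤ 1 := by
    intro i
    simp only [w, div_eq_mul_inv]
    rw [ENNReal.tsum_mul_right, ENNReal.tsum_add, ← div_eq_mul_inv]
    refine hhalf ?_ ?_
    · refine le_of_eq_of_le (tsum_congr fun k => ?_)
        ((he.tsum_enorm_inner_sq_le (D.basis i)).trans (hnorm (D.basis.orthonormal.1 i)))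
      rw [← ofReal_norm, ← ofReal_norm, norm_inner_symm]
    · refine (hf.tsum_enorm_inner_sq_le (D.leftVector i)).trans ?_
      exact pow_le_one₀ (zero_le) (D.enorm_leftVector_le i)
  calc ∑' k, ‖inner ℂ (f k) (T (e k))‖ₑ ^ p
      ≤ ∑' k, ∑' i, w k i * ENNReal.ofReal (D.val i) ^ p := by
        refine ENNReal.tsum_le_tsum fun k => ?_
        refine (ENNReal.rpow_le_rpow (D.enorm_inner_apply_le (e k) (f k)) (by linarith)).trans ?_
        exact ENNReal.rpow_tsum_mul_le_tsum_mul_rpow (w k) _ (hrow k) hp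
    _ = ∑' i, (∑' k, w k i) * ENNReal.ofReal (D.val i) ^ p := by
        rw [ENNReal.tsum_comm]
        exact tsum_congr fun i => ENNReal.tsum_mul_right
    _ ≤ ∑' i, ENNReal.ofReal (D.val i) ^ p := by
        refine ENNReal.tsum_le_tsum fun i => ?_
        exact mul_le_of_le_one_left (zero_le) (hcol i)

/-- The singular vectors of `T` itself attain the preceding bound. -/
theorem tsum_enorm_inner_leftVector_rpow {p : ℝ} (hp : 0 < p) :
    ∑' i : {i // D.val i ≠ 0}, ‖inner ℂ (D.leftVector i) (T (D.basis i))‖ₑ ^ p =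
      ∑' i, ENNReal.ofReal (D.val i) ^ p := by
  rw [← tsum_subtype_eq_of_support_subset (s := {i | D.val i ≠ 0})]
  · refine tsum_congr fun i => ?_
    rw [D.inner_leftVector_apply_basis, ← ofReal_norm, Complex.norm_real,
      Real.norm_of_nonneg (D.val_nonneg _)]
  · intro i hi h0
    refine hi ?_
    simp [h0, hp]

end ModulusEigenbasis

variable {K : Type u} [NormedAddCommGroup K] [InnerProductSpace ℂ K] [CompleteSpace K]

/-- Test `S + T` on its own singular vectors, where the bound is attained, split by Minkowski, and
bound the two parts by the variational inequality for `S` and `T`. -/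
theorem Lp_singularValue_add_le {S T : K →L[ℂ] K} (hS : IsCompactOperator S)
    (hT : IsCompactOperator T) {p : ℝ} (hp : 1 ≤ p) :
    (∑' n, ENNReal.ofReal (singularValue (S + T) n ^ p)) ^ (1 / p) ≤
      (∑' n, ENNReal.ofReal (singularValue S n ^ p)) ^ (1 / p) +
        (∑' n, ENNReal.ofReal (singularValue T n ^ p)) ^ (1 / p) := by
  have hp0 : 0 < p := by linarith
  obtain ⟨ι, ⟨D⟩⟩ := exists_modulusEigenbasis (T := S + T) (hS.add hT)
  obtain ⟨ι₁, ⟨D₁⟩⟩ := exists_modulusEigenbasis hS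
  obtain ⟨ι₂, ⟨D₂⟩⟩ := exists_modulusEigenbasis hT
  rw [D.tsum_ofReal_singularValue_rpow hp0, D₁.tsum_ofReal_singularValue_rpow hp0,
    D₂.tsum_ofReal_singularValue_rpow hp0]
  simp_rw [← fun i => ENNReal.ofReal_rpow_of_nonneg (D.val_nonneg i) hp0.le,
    ← fun i => ENNReal.ofReal_rpow_of_nonneg (D₁.val_nonneg i) hp0.le,
    ← fun i => ENNReal.ofReal_rpow_of_nonneg (D₂.val_nonneg i) hp0.le]
  rw [← D.tsum_enorm_inner_leftVector_rpow hp0]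
  have he : Orthonormal ℂ fun i : {i // D.val i ≠ 0} => D.basis i :=
    D.basis.orthonormal.comp _ Subtype.val_injective
  refine le_trans ?_ ((ENNReal.Lp_add_le_tsum
    (fun i : {i // D.val i ≠ 0} => ‖inner ℂ (D.leftVector i) (S (D.basis i))‖ₑ)
    (fun i => ‖inner ℂ (D.leftVector i) (T (D.basis i))‖ₑ) hp).trans ?_)
  · gcongr with i
    rw [_root_.add_apply, inner_add_right]
    exact enorm_add_le _ _
  · gcongr
    · exact D₁.tsum_enorm_inner_apply_rpow_le he D.orthonormal_leftVector hp
    · exact D₂.tsum_enorm_inner_apply_rpow_le he D.orthonormal_leftVector hp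

end SchattenTriangle

/-! ### Complete norms: a sequential criterion and transport along isomorphisms. -/

section BanachNorm

variable {V W : Type*} [AddCommGroup V] [Module ℂ V] [AddCommGroup W] [Module ℂ W]

/-- Everything is phrased through the function `N`, so applications need not handle the instances
built from it. -/
theorem IsBanachNorm.of_cauchy {N : V → ℝ} (hnonneg : ∀ x, 0 ≤ N x)
    (hsmul : ∀ (z : ℂ) x, N (z • x) = ‖z‖ * N x) (hadd : ∀ x y, N (x + y) ≤ N x + N y)
    (heq : ∀ x, N x = 0 → x = 0)
    (hcomplete : ∀ u : ℕ → V, (∀ ε > 0, ∃ n₀, ∀ m ≥ n₀, ∀ n ≥ n₀, N (u m - u n) < ε) →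
      ∃ a, ∀ ε > 0, ∃ n₀, ∀ n ≥ n₀, N (u n - a) < ε) : IsBanachNorm N := by
  let _ : Norm V := ⟨N⟩
  have core : NormedSpace.Core ℂ V :=
    { norm_nonneg := hnonneg
      norm_smul := hsmul
      norm_triangle := hadd
      norm_eq_zero_iff := fun x => ⟨heq x, fun h => by
        have h0 := hsmul 0 x
        rw [zero_smul, norm_zero, zero_mul] at h0
        rw [h]; exact h0⟩ }
  refine ⟨core, ?_⟩
  let _ : NormedAddCommGroup V := NormedAddCommGroup.ofCore core
  refine Metric.complete_of_cauchySeq_tendsto fun u hu => ?_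
  obtain ⟨a, ha⟩ := hcomplete u fun ε hε => by
    obtain ⟨n₀, h⟩ := Metric.cauchySeq_iff.1 hu ε hε
    exact ⟨n₀, fun m hm n hn => 
      (dist_eq_norm (u m) (u n)).symm.trans_lt (h m hm n hn)⟩
  refine ⟨a, Metric.tendsto_atTop.2 fun ε hε => ?_⟩
  obtain ⟨n₀, h⟩ := ha ε hε
  exact ⟨n₀, fun n hn => (dist_eq_norm (u n) a).trans_lt (h n hn)⟩

theorem IsBanachNorm.comp_linearEquiv {N : W → ℝ} (hN : IsBanachNorm N) (Φ : V ≃ₗ[ℂ] W) :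
    IsBanachNorm fun x => N (Φ x) := by
  obtain ⟨core, hcomplete⟩ := hN
  let _ : Norm W := ⟨N⟩
  let _ : Norm V := ⟨fun x => N (Φ x)⟩
  have coreV : NormedSpace.Core ℂ V :=
    { norm_nonneg := fun x => core.norm_nonneg (Φ x)
      norm_smul := fun z x => by
        change N (Φ (z • x)) = ‖z‖ * N (Φ x)
        rw [map_smul]; exact core.norm_smul z (Φ x)
      norm_triangle := fun x y => by
        change N (Φ (x + y)) ≤ N (Φ x) + N (Φ y)
        rw [map_add]; exact core.norm_triangle (Φ x) (Φ y)
      norm_eq_zero_iff := fun x => (core.norm_eq_zero_iff (Φ x)).trans Φ.map_eq_zero_iff }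
  refine ⟨coreV, ?_⟩
  let _ : NormedAddCommGroup W := NormedAddCommGroup.ofCore core
  let _ : NormedAddCommGroup V := NormedAddCommGroup.ofCore coreV
  have hΦ : Isometry Φ := AddMonoidHomClass.isometry_of_norm Φ fun _ => rfl
  have : CompleteSpace W := hcomplete
  exact (IsometryEquiv.mk Φ.toEquiv hΦ).completeSpace

end BanachNorm

/-! ### Schatten classes of a complex Hilbert space. -/

section SchattenClass

theorem lpQuasiNorm_eq_norm {p : ℝ≥0∞} (hp : 0 < p) (s : lp (fun _ : ℕ => ℝ) p) :
    lpQuasiNorm p s = ‖s‖ := by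
  rcases eq_or_ne p ∞ with rfl | hp'
  · rw [lp.norm_eq_ciSup, lpQuasiNorm, if_pos rfl]; rfl
  · rw [lp.norm_eq_tsum_rpow (ENNReal.toReal_pos hp.ne' hp'), lpQuasiNorm, if_neg hp']; rfl

theorem lpQuasiNorm_nonneg {p : ℝ≥0∞} (s : ℕ → ℝ) : 0 ≤ lpQuasiNorm p s := by
  rw [lpQuasiNorm]
  split_ifs
  · exact Real.iSup_nonneg fun _ => abs_nonneg _
  · positivity

/-- Membership matters: a divergent real `tsum` is 0, while the extended one is ∞. -/
theorem ofReal_lpQuasiNorm {p : ℝ≥0∞} (hp : 0 < p) (hp' : p ≠ ∞) {s : ℕ → ℝ} (hs : ∀ n, 0 ≤ s n)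
    (h : Memℓp s p) : ENNReal.ofReal (lpQuasiNorm p s) =
      (∑' n, ENNReal.ofReal (s n ^ p.toReal)) ^ (1 / p.toReal) := by
  have hp0 := ENNReal.toReal_pos hp.ne' hp'
  have hsum := (memℓp_gen_iff hp0).1 h
  simp only [Real.norm_of_nonneg (hs _)] at hsum
  rw [lpQuasiNorm, if_neg hp']
  simp only [abs_of_nonneg (hs _)]
  have hnn : ∀ n, 0 ≤ s n ^ p.toReal := fun n => Real.rpow_nonneg (hs n) _
  rw [← ENNReal.ofReal_tsum_of_nonneg hnn hsum,
    ENNReal.ofReal_rpow_of_nonneg (tsum_nonneg hnn) (by positivity)]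

variable {K : Type u} [NormedAddCommGroup K] [InnerProductSpace ℂ K] [CompleteSpace K]

/-- For finite `p`, both s_{2k} and s_{2k+1} of the sum are at most s_k(S) + s_k(T), so even and odd
indices are summed separately. No triangle inequality is needed, hence p < 1 is allowed. -/
theorem memℓp_singularValue_add {p : ℝ≥0∞} (hp : 0 < p) {S T : K →L[ℂ] K}
    (hS : S ∈ schattenClass K p) (hT : T ∈ schattenClass K p) :
    Memℓp (singularValue (S + T)) p := by
  rcases eq_or_ne p ∞ with rfl | hp'
  · refine memℓp_infty ⟨‖S + T‖, ?_⟩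
    rintro _ ⟨n, rfl⟩
    change ‖singularValue (S + T) n‖ ≤ ‖S + T‖
    rw [Real.norm_of_nonneg (singularValue_nonneg _ n)]
    exact singularValue_le_norm (T := S + T) (hS.1.add hT.1) n
  · have hp0 := ENNReal.toReal_pos hp.ne' hp'
    have hsum := (memℓp_gen_iff hp0).1 (hS.2.add hT.2)
    have key : ∀ f : ℕ → ℕ, (∀ k, k + k ≤ f k) →
        Summable fun k => ‖singularValue (S + T) (f k)‖ ^ p.toReal := by
      intro f hf
      refine hsum.of_nonneg_of_le (fun k => by positivity) fun k => ?_
      have h := (singularValue_antitone (T := S + T) (hS.1.add hT.1) (hf k)).trans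
        (singularValue_add_le hS.1 hT.1 k k)
      have h' : ‖singularValue (S + T) (f k)‖ ≤ ‖(singularValue S + singularValue T) k‖ := by
        rw [Real.norm_of_nonneg (singularValue_nonneg _ _)]
        exact h.trans (le_abs_self _)
      exact Real.rpow_le_rpow (norm_nonneg _) h' hp0.le
    refine (memℓp_gen_iff hp0).2 ?_
    have heven := (key (fun k => 2 * k) fun k => by omega).hasSum
    have hodd := (key (fun k => 2 * k + 1) fun k => by omega).hasSum
    exact (HasSum.even_add_odd (f := fun n => ‖singularValue (S + T) n‖ ^ p.toReal)
      heven hodd).summable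

theorem singularValue_smul_eq {T : K →L[ℂ] K} (hT : IsCompactOperator T) (z : ℂ) :
    singularValue (z • T) = ‖z‖ • singularValue T :=
  funext fun n => singularValue_smul hT z n

variable (K) in
/-- The Schatten class as a linear subspace. -/
def schattenSubmodule (p : ℝ≥0∞) (hp : 0 < p) : Submodule ℂ (K →L[ℂ] K) where
  carrier := schattenClass K p
  zero_mem' := by
    have h0 : IsCompactOperator (0 : K →L[ℂ] K) := isCompactOperator_zero
    refine ⟨h0, ?_⟩
    have h := singularValue_smul_eq h0 0
    rw [smul_zero, norm_zero, zero_smul] at h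
    rw [h]
    exact zero_memℓp
  add_mem' hS hT := ⟨hS.1.add hT.1, memℓp_singularValue_add hp hS hT⟩
  smul_mem' z T hT := ⟨hT.1.smul z, by
    rw [singularValue_smul_eq hT.1]; exact hT.2.const_smul ‖z‖⟩

theorem schattenNorm_smul {p : ℝ≥0∞} (hp : 0 < p) {T : K →L[ℂ] K} (hT : T ∈ schattenClass K p)
    (z : ℂ) : schattenNorm p (z • T) = ‖z‖ * schattenNorm p T := by
  have h := lpQuasiNorm_eq_norm hp (‖z‖ • (⟨singularValue T, hT.2⟩ : lp (fun _ : ℕ => ℝ) p))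
  rw [lp.norm_const_smul hp.ne', ← lpQuasiNorm_eq_norm hp, norm_norm] at h
  rw [schattenNorm, singularValue_smul_eq hT.1]
  exact h

/-- The operator norm is the entry s₀. This gives definiteness and makes Schatten–Cauchy sequences
converge in operator norm. -/
theorem norm_le_schattenNorm {p : ℝ≥0∞} (hp : 0 < p) {T : K →L[ℂ] K}
    (hT : T ∈ schattenClass K p) : ‖T‖ ≤ schattenNorm p T := by
  have h := lp.norm_apply_le_norm hp.ne' (⟨singularValue T, hT.2⟩ : lp (fun _ : ℕ => ℝ) p) 0
  rw [← lpQuasiNorm_eq_norm hp] at h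
  rw [← singularValue_zero_eq_norm hT.1]
  exact (le_abs_self _).trans h

theorem schattenNorm_top {T : K →L[ℂ] K} (hT : IsCompactOperator T) : schattenNorm ∞ T = ‖T‖ := by
  have h : ∀ n, |singularValue T n| ≤ ‖T‖ := fun n => by
    rw [abs_of_nonneg (singularValue_nonneg T n)]
    exact singularValue_le_norm hT n
  refine le_antisymm ?_ ?_
  · rw [schattenNorm, lpQuasiNorm, if_pos rfl]
    exact ciSup_le h
  · refine norm_le_schattenNorm ENNReal.zero_lt_top ⟨hT, memℓp_infty ⟨‖T‖, ?_⟩⟩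
    rintro _ ⟨n, rfl⟩
    exact h n

theorem schattenNorm_add_le {p : ℝ≥0∞} (hp : 1 ≤ p) {S T : K →L[ℂ] K}
    (hS : S ∈ schattenClass K p) (hT : T ∈ schattenClass K p) :
    schattenNorm p (S + T) ≤ schattenNorm p S + schattenNorm p T := by
  have hp0 : 0 < p := zero_lt_one.trans_le hp
  rcases eq_or_ne p ∞ with rfl | hp'
  · rw [schattenNorm_top (T := S + T) (hS.1.add hT.1), schattenNorm_top hS.1,
      schattenNorm_top hT.1]
    exact norm_add_le S T
  · have hp1 : 1 ≤ p.toReal := by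
      rwa [← ENNReal.toReal_one, ENNReal.toReal_le_toReal ENNReal.one_ne_top hp']
    have h := Lp_singularValue_add_le hS.1 hT.1 hp1
    rw [← ofReal_lpQuasiNorm hp0 hp' (singularValue_nonneg _) (memℓp_singularValue_add hp0 hS hT),
      ← ofReal_lpQuasiNorm hp0 hp' (singularValue_nonneg _) hS.2,
      ← ofReal_lpQuasiNorm hp0 hp' (singularValue_nonneg _) hT.2,
      ← ENNReal.ofReal_add (lpQuasiNorm_nonneg _) (lpQuasiNorm_nonneg _)] at h
    exact (ENNReal.ofReal_le_ofReal_iff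
      (add_nonneg (lpQuasiNorm_nonneg _) (lpQuasiNorm_nonneg _))).1 h

/-- Fatou's lemma for Schatten classes. -/
theorem mem_schattenClass_of_tendsto {p : ℝ≥0∞} (hp : 1 ≤ p) {u : ℕ → K →L[ℂ] K} {T : K →L[ℂ] K}
    (hu : ∀ n, u n ∈ schattenClass K p) (hT : Filter.Tendsto u Filter.atTop (nhds T)) {C : ℝ}
    (hC : ∀ n, schattenNorm p (u n) ≤ C) : T ∈ schattenClass K p ∧ schattenNorm p T ≤ C := by
  have hp0 : 0 < p := zero_lt_one.trans_le hp
  have : Fact (1 ≤ p) := ⟨hp⟩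
  have hTc : IsCompactOperator T := isCompactOperator_of_tendsto hT (.of_forall fun n => (hu n).1)
  let F : ℕ → lp (fun _ : ℕ => ℝ) p := fun n => ⟨singularValue (u n), (hu n).2⟩
  have hF : ∀ n, ‖F n‖ ≤ C := fun n => by
    rw [← lpQuasiNorm_eq_norm hp0]; exact hC n
  -- Each singular value is 1-Lipschitz in the operator norm, so the sequences converge entrywise.
  have hlim : Filter.Tendsto (id fun n => (F n : ℕ → ℝ)) Filter.atTop
      (nhds (singularValue T)) := by
    rw [tendsto_pi_nhds]
    intro k
    rw [tendsto_iff_norm_sub_tendsto_zero] at hT ⊢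
    exact squeeze_zero (fun n => norm_nonneg _)
      (fun n => abs_singularValue_sub_le (hu n).1 hTc k) hT
  have hmem : Memℓp (singularValue T) p := by
    refine lp.memℓp_of_tendsto (F := F) ?_ hlim
    rw [isBounded_iff_forall_norm_le]
    exact ⟨C, by rintro _ ⟨n, rfl⟩; exact hF n⟩
  refine ⟨⟨hTc, hmem⟩, ?_⟩
  have h := lp.norm_le_of_tendsto (f := ⟨singularValue T, hmem⟩) (.of_forall hF) hlim
  rwa [← lpQuasiNorm_eq_norm hp0] at h

theorem isBanachNorm_schattenNorm {p : ℝ≥0∞} (hp : 1 ≤ p) (hp0 : 0 < p) :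
    IsBanachNorm fun T : schattenSubmodule K p hp0 => schattenNorm p (T : K →L[ℂ] K) := by
  refine IsBanachNorm.of_cauchy (fun T => lpQuasiNorm_nonneg _)
    (fun z T => schattenNorm_smul hp0 T.2 z) (fun S T => schattenNorm_add_le hp S.2 T.2)
    (fun T hT => Subtype.ext (norm_le_zero_iff.1 ((norm_le_schattenNorm hp0 T.2).trans hT.le)))
    fun u hu => ?_
  have hcauchy : CauchySeq fun n => (u n : K →L[ℂ] K) := by
    refine Metric.cauchySeq_iff.2 fun ε hε => ?_
    obtain ⟨n₀, h⟩ := hu ε hε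
    refine ⟨n₀, fun m hm n hn => ?_⟩
    rw [dist_eq_norm]
    exact (norm_le_schattenNorm hp0 (u m - u n).2).trans_lt (h m hm n hn)
  obtain ⟨T, hT⟩ := cauchySeq_tendsto_of_complete hcauchy
  have key : ∀ ε > 0, ∃ n₀, ∀ n ≥ n₀, (u n : K →L[ℂ] K) - T ∈ schattenClass K p ∧
      schattenNorm p ((u n : K →L[ℂ] K) - T) < ε := by
    intro ε hε
    obtain ⟨n₀, h⟩ := hu (ε / 2) (by positivity)
    refine ⟨n₀, fun n hn => ?_⟩
    -- Fix `n` and let `m` tend to infinity in u n - u (m + n₀). The limit keeps only a weak bound,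
    -- hence the choice ε/2.
    obtain ⟨h1, h2⟩ := mem_schattenClass_of_tendsto hp
      (u := fun m => (u n - u (m + n₀) : K →L[ℂ] K))
      (fun m => (u n - u (m + n₀)).2)
      (tendsto_const_nhds.sub (hT.comp (Filter.tendsto_add_atTop_nat n₀)))
      (fun m => (h n hn (m + n₀) (Nat.le_add_left _ _)).le)
    exact ⟨h1, h2.trans_lt (by linarith)⟩
  obtain ⟨n₁, h₁⟩ := key 1 one_pos
  have hmem : T ∈ schattenSubmodule K p hp0 := by
    have h := (schattenSubmodule K p hp0).sub_mem (u n₁).2 (h₁ n₁ le_rfl).1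
    rwa [sub_sub_cancel] at h
  refine ⟨⟨T, hmem⟩, fun ε hε => ?_⟩
  obtain ⟨n₀, h⟩ := key ε hε
  exact ⟨n₀, fun n hn => (h n hn).2⟩

end SchattenClass

/-! ### Splitting the quaternions as ℂ_i ⊕ ℂ_i j. -/

namespace ImaginaryUnit

variable (i : ImaginaryUnit)

theorem val_mul_self : i.val * i.val = -1 := by
  have h := i.sq_sum
  have h0 := i.re_eq_zero
  ext
  · simp [h0]; linear_combination -h
  all_goals simp [h0]; try ring

theorem embed_commutes (z : ℂ) : i.embed z * i.val = i.val * i.embed z := by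
  simp [embed, mul_add, add_mul, mul_assoc, Quaternion.coe_commutes]

theorem embed_ofReal (r : ℝ) : i.embed r = (r : ℍ[ℝ]) := by
  simp [embed]

theorem exists_anticommuting : ∃ j : ImaginaryUnit, i.val * j.val = -(j.val * i.val) := by
  obtain ⟨q, hq0, hq, hiq⟩ : ∃ q : ℍ[ℝ], q ≠ 0 ∧ q.re = 0 ∧ i.val * q = -(q * i.val) := by
    have h0 := i.re_eq_zero
    have hmk : ∀ b c : ℝ, ∃ q : ℍ[ℝ], q.re = 0 ∧ q.imI = b ∧ q.imJ = c ∧ q.imK = 0 :=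
      fun b c => ⟨⟨0, b, c, 0⟩, rfl, rfl, rfl, rfl⟩
    -- An imaginary quaternion orthogonal to `i` anticommutes with it. Rotate the first two
    -- imaginary coordinates by a right angle, unless both vanish.
    by_cases h : i.val.imI = 0 ∧ i.val.imJ = 0
    · obtain ⟨q, hq0, hq1, hq2, hq3⟩ := hmk 1 0
      refine ⟨q, fun h => ?_, hq0, ?_⟩
      · simp [h] at hq1
      · ext <;> simp [h0, h.1, h.2, hq0, hq1, hq2, hq3]
    · obtain ⟨q, hq0, hq1, hq2, hq3⟩ := hmk (-i.val.imJ) i.val.imI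
      refine ⟨q, fun h' => h ⟨?_, ?_⟩, hq0, ?_⟩
      · simpa [h'] using hq2.symm
      · simpa [h'] using hq1
      · ext <;> simp [h0, hq0, hq1, hq2, hq3] <;> ring
  have hn : ‖q‖ ≠ 0 := norm_ne_zero_iff.2 hq0
  refine ⟨⟨‖q‖⁻¹ • q, by simp [hq], ?_⟩, ?_⟩
  · rw [norm_smul, norm_inv, norm_norm, inv_mul_cancel₀ hn]
  · rw [mul_smul_comm, hiq, smul_mul_assoc, smul_neg]

variable {i} {j : ImaginaryUnit}

theorem embed_mul_anticommuting (hij : i.val * j.val = -(j.val * i.val)) (z : ℂ) :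
    i.embed z * j.val = j.val * i.embed (starRingEnd ℂ z) := by
  change ((z.re : ℍ[ℝ]) + (z.im : ℍ[ℝ]) * i.val) * j.val =
    j.val * ((z.re : ℍ[ℝ]) + ((-z.im : ℝ) : ℍ[ℝ]) * i.val)
  rw [add_mul, mul_add, mul_assoc, hij, Quaternion.coe_commutes, Quaternion.coe_neg, neg_mul,
    mul_neg, mul_neg, ← mul_assoc, ← mul_assoc, Quaternion.coe_commutes z.im]

/-- For q = a + b with `a` commuting and `b` anticommuting with `i`, q - iqi = 2a and q + iqi = 2b;
then b(-j) commutes with `i` and is the coefficient of `j`. -/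
theorem exists_embed_add_embed_mul (hij : i.val * j.val = -(j.val * i.val))
    (q : ℍ[ℝ]) : ∃ z w : ℂ, q = i.embed z + i.embed w * j.val := by
  have hi := i.val_mul_self
  have hj := j.val_mul_self
  have h1 : (q - i.val * q * i.val) * i.val = i.val * (q - i.val * q * i.val) := by
    simp only [sub_mul, mul_sub, mul_assoc, hi]
    simp only [← mul_assoc, hi]
    simp only [mul_neg, neg_mul, mul_one, one_mul]
    abel
  have h2 : ((q + i.val * q * i.val) * -j.val) * i.val =
      i.val * ((q + i.val * q * i.val) * -j.val) := by
    have hij' : j.val * i.val = -(i.val * j.val) := by rw [hij, neg_neg]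
    simp only [add_mul, mul_add, mul_neg, neg_mul, mul_assoc, hij']
    have h3 : i.val * (i.val * (q * (i.val * j.val))) = -(q * (i.val * j.val)) := by
      rw [← mul_assoc, hi, neg_one_mul]
    have h4 : i.val * (i.val * j.val) = -j.val := by rw [← mul_assoc, hi, neg_one_mul]
    rw [h3, h4]
    simp only [mul_neg, neg_neg]
    abel
  refine ⟨(2⁻¹ : ℝ) * i.proj (q - i.val * q * i.val),
    (2⁻¹ : ℝ) * i.proj ((q + i.val * q * i.val) * -j.val), ?_⟩
  rw [map_mul, map_mul, i.embed_proj h1, i.embed_proj h2, i.embed_ofReal,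
    mul_assoc (_ : ℍ[ℝ]) _ j.val,
    mul_assoc _ _ j.val, neg_mul, hj, neg_neg, mul_one, ← mul_add, sub_add_add_cancel, ← two_mul,
      ← mul_assoc]
  have h3 : (((2⁻¹ : ℝ)) : ℍ[ℝ]) * 2 = 1 := by
    have : (2 : ℍ[ℝ]) = ((2 : ℝ) : ℍ[ℝ]) := by norm_cast
    rw [this, ← Quaternion.coe_mul, inv_mul_cancel₀ (by norm_num), Quaternion.coe_one]
  rw [h3, one_mul]

end ImaginaryUnit

/-! ### The splitting H = H₊ ⊕ H₊j and the extension of operators. -/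

section Decomposition

theorem rightSMul_rightSMul {M : Type*} [AddCommGroup M] [Module ℍ[ℝ]ᵐᵒᵖ M] (p q : ℍ[ℝ]) (x : M) :
    op p • op q • x = op (q * p) • x := by
  rw [smul_smul, ← MulOpposite.op_mul]

open QuaternionicInnerProductSpace

variable {H : Type u} [NormedAddCommGroup H] [Module ℍ[ℝ]ᵐᵒᵖ H] [QuaternionicInnerProductSpace H]
  [CompleteSpace H] (J : AntiSelfadjointUnitary H) (i j : ImaginaryUnit)

variable {J i} in
/-- The underlying vector of `H`. -/
def HPlus.vec (x : HPlus J i) : H := x.1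

variable {J i} in
/-- A vector `x` with `J x = x i`, as an element of `H₊^{Ji}`. -/
def HPlus.of (x : H) (hx : J.toOp x = op i.val • x) : HPlus J i := ⟨x, hx⟩

variable {J i} in
theorem HPlus.apply_vec (x : HPlus J i) : J.toOp (HPlus.vec x) = op i.val • HPlus.vec x := x.2

variable {J i} in
theorem HPlus.vec_injective : Function.Injective (HPlus.vec : HPlus J i → H) :=
  Subtype.val_injective

theorem HPlus.continuous_vec : Continuous (HPlus.vec : HPlus J i → H) := continuous_subtype_val

/-- The component in `H₊^{Ji}` of a vector of `H = H₊^{Ji} ⊕ H₊^{Ji} j`. -/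
def plusPart (x : H) : H := op ((2⁻¹ : ℝ) : ℍ[ℝ]) • (x - op i.val • J.toOp x)

/-- The vector `y` of `H₊^{Ji}` such that `y j` is the second component of a vector of
`H = H₊^{Ji} ⊕ H₊^{Ji} j`. -/
def minusPart (x : H) : H := op (-j.val) • (x - plusPart J i x)

theorem continuous_plusPart : Continuous (plusPart J i) :=
  (continuous_op_smul _).comp
    (continuous_id.sub ((continuous_op_smul _).comp J.toOp.continuous))

theorem continuous_minusPart : Continuous (minusPart J i j) :=
  (continuous_op_smul _).comp (continuous_id.sub (continuous_plusPart J i))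

theorem plusPart_add_smul_minusPart (x : H) :
    plusPart J i x + op j.val • minusPart J i j x = x := by
  rw [minusPart, rightSMul_rightSMul, neg_mul, j.val_mul_self, neg_neg, MulOpposite.op_one,
    one_smul,
    add_sub_cancel]

theorem apply_plusPart (x : H) : J.toOp (plusPart J i x) = op i.val • plusPart J i x := by
  rw [plusPart, map_smul, map_sub, map_smul, J.apply_apply, rightSMul_rightSMul,
    Quaternion.coe_commutes, ← rightSMul_rightSMul, smul_sub (op i.val),
    rightSMul_rightSMul i.val, i.val_mul_self, MulOpposite.op_neg, MulOpposite.op_one, neg_smul,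
    one_smul, smul_neg]
  congr 1
  abel

theorem apply_sub_plusPart (x : H) :
    J.toOp (x - plusPart J i x) = -(op i.val • (x - plusPart J i x)) := by
  have h2 : op ((2⁻¹ : ℝ) : ℍ[ℝ]) • (x + x) = x := by
    rw [← two_smul ℍ[ℝ]ᵐᵒᵖ x, smul_smul]
    have : (2 : ℍ[ℝ]ᵐᵒᵖ) = op (((2 : ℝ)) : ℍ[ℝ]) := by norm_cast
    rw [this, ← MulOpposite.op_mul, ← Quaternion.coe_mul, mul_inv_cancel₀ (by norm_num),
      Quaternion.coe_one, MulOpposite.op_one, one_smul]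
  have h : x - plusPart J i x = op ((2⁻¹ : ℝ) : ℍ[ℝ]) • (x + op i.val • J.toOp x) := by
    rw [sub_eq_iff_eq_add, plusPart, ← smul_add, add_add_sub_cancel, h2]
  rw [h, map_smul, map_add, map_smul, J.apply_apply, rightSMul_rightSMul i.val,
    Quaternion.coe_commutes, ← rightSMul_rightSMul, ← smul_neg, smul_add (op i.val),
    rightSMul_rightSMul i.val, i.val_mul_self, MulOpposite.op_neg, MulOpposite.op_one, neg_smul,
    one_smul, smul_neg]
  congr 1
  abel

variable {i j}

/-- The remainder satisfies Jy = -yi, and right multiplication by -j turns the sign around because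
`i` and `j` anticommute. -/
theorem apply_minusPart (hij : i.val * j.val = -(j.val * i.val)) (x : H) :
    J.toOp (minusPart J i j x) = op i.val • minusPart J i j x := by
  rw [minusPart, map_smul, apply_sub_plusPart, smul_neg, rightSMul_rightSMul, rightSMul_rightSMul,
    mul_neg,
    neg_mul, hij, neg_neg, MulOpposite.op_neg, neg_smul]

variable {J} in
-- `plusPart` kills bj and fixes `a`, so it recovers `a` from a + bj; cancelling `j` then recovers
-- `b`.
theorem decomposition_unique (hij : i.val * j.val = -(j.val * i.val)) {a b a' b' : H}
    (ha : J.toOp a = op i.val • a)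
    (hb : J.toOp b = op i.val • b) (ha' : J.toOp a' = op i.val • a')
    (hb' : J.toOp b' = op i.val • b') (h : a + op j.val • b = a' + op j.val • b') :
    a = a' ∧ b = b' := by
  have key : ∀ {a b : H}, J.toOp a = op i.val • a → J.toOp b = op i.val • b →
      plusPart J i (a + op j.val • b) = a := by
    intro a b ha hb
    rw [plusPart, map_add, map_smul, ha, hb, rightSMul_rightSMul, hij, smul_add,
      rightSMul_rightSMul,
      rightSMul_rightSMul, neg_mul, mul_assoc, i.val_mul_self, mul_neg, neg_neg, mul_one,
      MulOpposite.op_neg, MulOpposite.op_one, neg_smul, one_smul, ← sub_sub, sub_neg_eq_add,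
      add_right_comm, add_sub_cancel_right, ← two_smul ℍ[ℝ]ᵐᵒᵖ a, smul_smul]
    have : (2 : ℍ[ℝ]ᵐᵒᵖ) = op (((2 : ℝ)) : ℍ[ℝ]) := by norm_cast
    rw [this, ← MulOpposite.op_mul, ← Quaternion.coe_mul, mul_inv_cancel₀ (by norm_num),
      Quaternion.coe_one, MulOpposite.op_one, one_smul]
  have h1 : a = a' := by rw [← key ha hb, h, key ha' hb']
  rw [h1] at h
  have h2 := congrArg (op (-j.val) • ·) (add_left_cancel h)
  simp only [rightSMul_rightSMul, mul_neg, j.val_mul_self, neg_neg, MulOpposite.op_one,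
    one_smul] at h2
  exact ⟨h1, h2⟩

variable {J} in
theorem apply_embed_smul {a : H} (ha : J.toOp a = op i.val • a) (z : ℂ) :
    J.toOp (op (i.embed z) • a) = op i.val • op (i.embed z) • a := by
  rw [map_smul, ha, rightSMul_rightSMul, rightSMul_rightSMul, i.embed_commutes]

/-- Every bounded operator on `H₊^{Ji}` extends to a bounded right linear operator on `H` that
commutes with `J`. -/
theorem exists_extension (hij : i.val * j.val = -(j.val * i.val))
    (S : HPlus J i →L[ℂ] HPlus J i) : ∃ T : commutantOp J, resJ J i T = S := by
  let p : H → HPlus J i := fun x => HPlus.of _ (apply_plusPart J i x)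
  let m : H → HPlus J i := fun x => HPlus.of _ (apply_minusPart J hij x)
  let v : HPlus J i → H := HPlus.vec
  have hv : ∀ x, J.toOp (v x) = op i.val • v x := HPlus.apply_vec
  have hv_add : ∀ x y, v (x + y) = v x + v y := fun _ _ => rfl
  have hv_neg : ∀ x, v (-x) = -v x := fun _ => rfl
  have hv_smul : ∀ (z : ℂ) x, v (z • x) = op (i.embed z) • v x := fun _ _ => rfl
  have hv_inj : ∀ {x y}, v x = v y → x = y := fun h => HPlus.vec_injective h
  have hvp : ∀ x, v (p x) + op j.val • v (m x) = x := plusPart_add_smul_minusPart J i j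
  -- By uniqueness, every identity for `p` and `m` below is proved by exhibiting a decomposition.
  have hpm : ∀ {x : H} {a b : HPlus J i}, v a + op j.val • v b = x → p x = a ∧ m x = b := by
    intro x a b h
    have h1 := decomposition_unique hij (hv (p x)) (hv (m x)) (hv a) (hv b) ((hvp x).trans h.symm)
    exact ⟨hv_inj h1.1, hv_inj h1.2⟩
  have hadd : ∀ x y, p (x + y) = p x + p y ∧ m (x + y) = m x + m y := fun x y => by
    refine hpm ?_
    rw [hv_add, hv_add, smul_add, add_add_add_comm, hvp, hvp]
  -- Moving `z` past `j` conjugates it, so `m` is conjugate-linear; the factor `j` in the definition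
  -- of `f` undoes this.
  have hz : ∀ (z : ℂ) x, p (op (i.embed z) • x) = z • p x ∧
      m (op (i.embed z) • x) = (starRingEnd ℂ z) • m x := fun z x => by
    refine hpm ?_
    conv_rhs => rw [← hvp x]
    rw [hv_smul, hv_smul, smul_add, rightSMul_rightSMul, rightSMul_rightSMul,
      i.embed_mul_anticommuting hij, Complex.conj_conj]
  have hj : ∀ x, p (op j.val • x) = -m x ∧ m (op j.val • x) = p x := fun x => by
    refine hpm ?_
    conv_rhs => rw [← hvp x]
    rw [hv_neg, smul_add, rightSMul_rightSMul, j.val_mul_self, MulOpposite.op_neg,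
      MulOpposite.op_one,
      neg_smul, one_smul, add_comm]
  -- Right linearity forces this formula.
  let f : H → H := fun x => v (S (p x)) + op j.val • v (S (m x))
  have hf_add : ∀ x y, f (x + y) = f x + f y := fun x y => by
    simp only [f]
    rw [(hadd x y).1, (hadd x y).2, map_add, map_add, hv_add, hv_add, smul_add, add_add_add_comm]
  have hf_z : ∀ (z : ℂ) x, f (op (i.embed z) • x) = op (i.embed z) • f x := fun z x => by
    simp only [f]
    rw [(hz z x).1, (hz z x).2, map_smul, map_smul, hv_smul, hv_smul, smul_add, rightSMul_rightSMul,
      rightSMul_rightSMul, i.embed_mul_anticommuting hij, Complex.conj_conj]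
  have hf_j : ∀ x, f (op j.val • x) = op j.val • f x := fun x => by
    simp only [f]
    rw [(hj x).1, (hj x).2, map_neg, hv_neg, smul_add, rightSMul_rightSMul, j.val_mul_self,
      MulOpposite.op_neg, MulOpposite.op_one, neg_smul, one_smul, add_comm]
  have hf_smul : ∀ (q : ℍ[ℝ]) x, f (op q • x) = op q • f x := fun q x => by
    obtain ⟨z, w, rfl⟩ := ImaginaryUnit.exists_embed_add_embed_mul hij q
    rw [MulOpposite.op_add, add_smul, hf_add, hf_z, ← rightSMul_rightSMul, hf_j, hf_z, add_smul,
      ← rightSMul_rightSMul]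
  have hp_cont : Continuous p := (continuous_plusPart J i).subtype_mk _
  have hm_cont : Continuous m := (continuous_minusPart J i j).subtype_mk _
  have hv_cont : Continuous v := continuous_subtype_val
  have hf_cont : Continuous f :=
    (hv_cont.comp (S.continuous.comp hp_cont)).add
      ((continuous_op_smul j.val).comp (hv_cont.comp (S.continuous.comp hm_cont)))
  let T : H →L[ℍ[ℝ]ᵐᵒᵖ] H :=
    ⟨⟨⟨f, hf_add⟩, fun q x => by obtain ⟨q⟩ := q; exact hf_smul q x⟩, hf_cont⟩
  have hfv : ∀ x, f (v x) = v (S x) := fun x => by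
    have h := hpm (x := v x) (a := x) (b := 0) (by
      change v x + op j.val • (0 : H) = v x
      rw [smul_zero, add_zero])
    simp only [f]
    rw [h.1, h.2, map_zero]
    change v (S x) + op j.val • (0 : H) = v (S x)
    rw [smul_zero, add_zero]
  have hfJ : ∀ x, f (J.toOp x) = J.toOp (f x) := fun x => by
    conv_lhs => rw [← hvp x]
    rw [map_add, map_smul, hv, hv, hf_add, hf_smul, hf_smul, hf_smul, hfv, hfv]
    simp only [f]
    rw [map_add, map_smul, hv, hv]
  exact ⟨⟨T, ContinuousLinearMap.ext hfJ⟩, ContinuousLinearMap.ext fun x => hv_inj (hfv x)⟩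

theorem resJ_injective (hij : i.val * j.val = -(j.val * i.val)) :
    Function.Injective (resJ J i) := by
  intro S T h
  have h1 : ∀ x : H, J.toOp x = op i.val • x → S.1 x = T.1 x := fun x hx =>
    congrArg HPlus.vec (DFunLike.congr_fun h (HPlus.of x hx))
  refine commutantOp_ext fun x => ?_
  rw [← plusPart_add_smul_minusPart J i j x, map_add, map_add, map_smul, map_smul,
    h1 _ (apply_plusPart J i x), h1 _ (apply_minusPart J hij x)]

/-- Linearity of `g` is not assumed, as the second component map is only conjugate-linear. -/
theorem IsCompactOperator.comp_continuous {M₁ M₂ M₃ : Type*} [Zero M₁] [TopologicalSpace M₁]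
    [Zero M₂] [TopologicalSpace M₂] [TopologicalSpace M₃] {f : M₂ → M₃} (hf : IsCompactOperator f)
    {g : M₁ → M₂} (hg : Continuous g) (hg0 : g 0 = 0) : IsCompactOperator (f ∘ g) := by
  obtain ⟨C, hC, hCf⟩ := hf
  refine ⟨C, hC, ?_⟩
  rw [← hg0] at hCf
  exact hg.continuousAt.preimage_mem_nhds hCf

/-- Tx is the sum of the restriction applied to the first component and, times `j`, to the second;
both component maps are continuous. -/
theorem isCompactOperator_resJ_iff (hij : i.val * j.val = -(j.val * i.val)) (T : commutantOp J) :
    IsCompactOperator (resJ J i T) ↔ IsCompactOperator T.1 := by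
  constructor
  · intro h
    let p : H → HPlus J i := fun x => HPlus.of _ (apply_plusPart J i x)
    let m : H → HPlus J i := fun x => HPlus.of _ (apply_minusPart J hij x)
    have hv_cont := HPlus.continuous_vec J i
    have hp0 : plusPart J i (0 : H) = 0 := by simp [plusPart]
    have hm0 : minusPart J i j (0 : H) = 0 := by simp [minusPart, hp0]
    have hp := (h.comp_continuous (g := p) ((continuous_plusPart J i).subtype_mk _)
      (HPlus.vec_injective hp0)).continuous_comp hv_cont
    have hm := (h.comp_continuous (g := m) ((continuous_minusPart J i j).subtype_mk _)
      (HPlus.vec_injective hm0)).continuous_comp ((continuous_op_smul j.val).comp hv_cont)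
    convert! hp.add hm using 1
    funext x
    change T.1 x = T.1 (plusPart J i x) + op j.val • T.1 (minusPart J i j x)
    rw [← map_smul, ← map_add, plusPart_add_smul_minusPart]
  · intro h
    exact IsCompactOperator.restrict' (f := (RightComplex.ofQ i T.1 : RightComplex H i →ₗ[ℂ] _)) h
      (V := HPlus J i) fun x hx => (resJ J i T ⟨x, hx⟩).2

end Decomposition

/-! ### Restriction preserves singular values. -/

section Restriction

theorem singularValue_eq_decreasingEnum {K : Type u} [NormedAddCommGroup K] [InnerProductSpace ℂ K]
    [CompleteSpace K] {A T : K →L[ℂ] K} (hA : 0 ≤ A) (h : A * A = star T * T) :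
    singularValue T = decreasingEnum fun μ =>
      Module.rank ℂ (Module.End.eigenspace (A : K →ₗ[ℂ] K) (μ : ℂ)) := by
  rw [singularValue, CFC.abs, CFC.sqrt_unique h hA]

open QuaternionicInnerProductSpace

variable {H : Type u} [NormedAddCommGroup H] [Module ℍ[ℝ]ᵐᵒᵖ H] [QuaternionicInnerProductSpace H]
theorem qinner_neg_left (x y : H) : qinner (-x) y = -qinner x y := by
  have h := qinner_smul_left x y (-1)
  simpa using h

theorem qinner_neg_right (x y : H) : qinner x (-y) = -qinner x y := by
  have h := qinner_smul_right x y (-1)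
  simpa using h

variable [CompleteSpace H] {J : AntiSelfadjointUnitary H} {i j : ImaginaryUnit}

theorem qinner_apply_left (J : AntiSelfadjointUnitary H) (x y : H) :
    qinner (J.toOp x) y = -qinner x (J.toOp y) := by
  have h := qadjoint_qinner J.toOp x y
  rw [J.anti_selfadjoint] at h
  rw [← h]
  change _ = -qinner (-J.toOp x) y
  rw [qinner_neg_left, neg_neg]

theorem qadjoint_mem_commutantOp (T : commutantOp J) : qadjoint T.1 ∈ commutantOp J := by
  refine ContinuousLinearMap.ext fun x => eq_of_qinner fun y => ?_
  change qinner (qadjoint T.1 (J.toOp x)) y = qinner (J.toOp (qadjoint T.1 x)) y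
  rw [qadjoint_qinner, qinner_apply_left, qinner_apply_left, qadjoint_qinner, commutantOp_apply]

/-- Since J* = -J, the operator -J|T|J = J*|T|J is positive, and its square is T*T because `J`
commutes with T*T. Uniqueness gives -J|T|J = |T|. -/
theorem qabs_mem_commutantOp (T : commutantOp J) : qabs T.1 ∈ commutantOp J := by
  obtain ⟨hpos, hsq⟩ := qabs_spec T.1
  have hsq' : ∀ x, qabs T.1 (qabs T.1 x) = qadjoint T.1 (T.1 x) := fun x => DFunLike.congr_fun hsq x
  have hadj : ∀ x, qadjoint T.1 (J.toOp x) = J.toOp (qadjoint T.1 x) :=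
    commutantOp_apply ⟨_, qadjoint_mem_commutantOp T⟩
  have h := (existsUnique_qabs T.1).unique (y₁ := -(J.toOp * qabs T.1 * J.toOp)) (y₂ := qabs T.1)
    ⟨fun x => ?_, ContinuousLinearMap.ext fun x => ?_⟩ ⟨hpos, hsq⟩
  · refine ContinuousLinearMap.ext fun x => ?_
    have hx : -J.toOp (qabs T.1 (J.toOp x)) = qabs T.1 x := DFunLike.congr_fun h x
    change qabs T.1 (J.toOp x) = J.toOp (qabs T.1 x)
    rw [← hx, map_neg, J.apply_apply, neg_neg]
  · obtain ⟨r, hr, hx⟩ := hpos (J.toOp x)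
    refine ⟨r, hr, ?_⟩
    change qinner x (-J.toOp (qabs T.1 (J.toOp x))) = _
    rw [qinner_neg_right, ← qinner_apply_left, hx]
  · change -J.toOp (qabs T.1 (J.toOp (-J.toOp (qabs T.1 (J.toOp x))))) = qadjoint T.1 (T.1 x)
    rw [map_neg, J.apply_apply, neg_neg, hsq', commutantOp_apply, hadj, J.apply_apply, neg_neg]

theorem star_resJ (T : commutantOp J) :
    star (resJ J i T) = resJ J i ⟨qadjoint T.1, qadjoint_mem_commutantOp T⟩ := by
  refine ((ContinuousLinearMap.eq_adjoint_iff _ _).2 fun x y => ?_).symm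
  exact congrArg i.proj (qadjoint_qinner T.1 (HPlus.vec x) (HPlus.vec y))

theorem resJ_nonneg {P : commutantOp J} (hP : QPositive P.1) : 0 ≤ resJ J i P := by
  have h := RightComplex.ofQ_nonneg i hP
  rw [ContinuousLinearMap.nonneg_iff_isPositive, ContinuousLinearMap.isPositive_iff_complex] at *
  exact fun x => h x.1

theorem resJ_qabs_mul_self (T : commutantOp J) :
    resJ J i ⟨qabs T.1, qabs_mem_commutantOp T⟩ * resJ J i ⟨qabs T.1, qabs_mem_commutantOp T⟩ =
      star (resJ J i T) * resJ J i T := by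
  rw [star_resJ]
  exact ContinuousLinearMap.ext fun x =>
    HPlus.vec_injective (DFunLike.congr_fun (qabs_spec T.1).2 (HPlus.vec x))

theorem commutantOp_apply_plusPart (T : commutantOp J) (x : H) :
    T.1 (plusPart J i x) = plusPart J i (T.1 x) := by
  rw [plusPart, plusPart, map_smul, map_sub, map_smul, commutantOp_apply]

theorem commutantOp_apply_minusPart (T : commutantOp J) (x : H) :
    T.1 (minusPart J i j x) = minusPart J i j (T.1 x) := by
  rw [minusPart, minusPart, map_smul, map_sub, commutantOp_apply_plusPart]

theorem vec_mem_qEigenspace_iff (P : commutantOp J) (r : ℝ) (x : HPlus J i) :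
    HPlus.vec x ∈ qEigenspace P.1 r ↔
      x ∈ Module.End.eigenspace (resJ J i P : HPlus J i →ₗ[ℂ] HPlus J i) (r : ℂ) := by
  rw [mem_qEigenspace, Module.End.mem_eigenspace_iff, ← HPlus.vec_injective.eq_iff,
    ← i.embed_ofReal]
  rfl

/-- A complex basis of E is a quaternionic basis of E ⊕ Ej. That `r` is real matters: it commutes
with `j`, so the eigenvalue equation splits into components. -/
theorem rank_qEigenspace (hij : i.val * j.val = -(j.val * i.val)) (P : commutantOp J) (r : ℝ) :
    Module.rank ℍ[ℝ]ᵐᵒᵖ (qEigenspace P.1 r) =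
      Module.rank ℂ
        (Module.End.eigenspace (resJ J i P : HPlus J i →ₗ[ℂ] HPlus J i) (r : ℂ)) := by
  set E := Module.End.eigenspace (resJ J i P : HPlus J i →ₗ[ℂ] HPlus J i) (r : ℂ) with hE
  let b := Module.Basis.ofVectorSpace ℂ E
  let ι := Module.Basis.ofVectorSpaceIndex ℂ E
  let vec : E →+ H :=
    { toFun := fun x => HPlus.vec x.1
      map_zero' := rfl
      map_add' := fun _ _ => rfl }
  have hvec_smul : ∀ (z : ℂ) x, vec (z • x) = op (i.embed z) • vec x := fun _ _ => rfl
  have hvec_inj : ∀ x, vec x = 0 → x = 0 := fun x h =>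
    Subtype.ext (HPlus.vec_injective h)
  have hvec_J : ∀ x, J.toOp (vec x) = op i.val • vec x := fun x => HPlus.apply_vec x.1
  let v : ι → qEigenspace P.1 r := fun k =>
    ⟨vec (b k), (vec_mem_qEigenspace_iff P r (b k).1).2 (b k).2⟩
  have hli : LinearIndependent ℍ[ℝ]ᵐᵒᵖ v := by
    rw [linearIndependent_iff']
    intro s g hg
    -- Split each coefficient as z + wj; a vanishing combination then yields two vanishing complex
    -- ones.
    choose z w hzw using fun k => ImaginaryUnit.exists_embed_add_embed_mul hij (g k).unop
    have h1 : vec (∑ k ∈ s, z k • b k) + op j.val • vec (∑ k ∈ s, w k • b k) = 0 := by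
      have h2 := congrArg (Submodule.subtype _) hg
      rw [map_sum, map_zero] at h2
      rw [map_sum, map_sum, Finset.smul_sum, ← Finset.sum_add_distrib, ← h2]
      refine Finset.sum_congr rfl fun k _ => ?_
      rw [hvec_smul, hvec_smul, rightSMul_rightSMul, ← add_smul, ← MulOpposite.op_add, ← hzw k,
        MulOpposite.op_unop]
      rfl
    have hJ0 : J.toOp (0 : H) = op i.val • (0 : H) := by simp
    obtain ⟨h3, h4⟩ := decomposition_unique hij (hvec_J _) (hvec_J _) hJ0 hJ0
      (h1.trans (by simp))
    have h5 := linearIndependent_iff'.1 b.linearIndependent s z (hvec_inj _ h3)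
    have h6 := linearIndependent_iff'.1 b.linearIndependent s w (hvec_inj _ h4)
    intro k hk
    apply MulOpposite.unop_injective
    rw [hzw k, h5 k hk, h6 k hk]
    simp
  have hspan : ⊤ ≤ Submodule.span ℍ[ℝ]ᵐᵒᵖ (Set.range v) := by
    have key : ∀ x : E, ∃ y ∈ Submodule.span ℍ[ℝ]ᵐᵒᵖ (Set.range v), (y : H) = vec x := by
      intro x
      refine Submodule.span_induction (p := fun x _ =>
        ∃ y ∈ Submodule.span ℍ[ℝ]ᵐᵒᵖ (Set.range v), (y : H) = vec x) ?_ ?_ ?_ ?_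
        (b.mem_span x)
      · rintro _ ⟨k, rfl⟩
        exact ⟨v k, Submodule.subset_span ⟨k, rfl⟩, rfl⟩
      · exact ⟨0, Submodule.zero_mem _, rfl⟩
      · rintro x y - - ⟨x', hx', hx⟩ ⟨y', hy', hy⟩
        exact ⟨x' + y', Submodule.add_mem _ hx' hy', by
          rw [Submodule.coe_add, hx, hy, map_add]⟩
      · rintro z x - ⟨x', hx', hx⟩
        exact ⟨op (i.embed z) • x', Submodule.smul_mem _ _ hx', by
          rw [Submodule.coe_smul, hx, hvec_smul]⟩
    rintro ⟨x, hx⟩ -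
    rw [mem_qEigenspace] at hx
    -- Compare the components of Px = xr.
    have hunique : plusPart J i (P.1 x) = op (r : ℍ[ℝ]) • plusPart J i x ∧
        minusPart J i j (P.1 x) = op (r : ℍ[ℝ]) • minusPart J i j x := by
      have hr := apply_embed_smul (apply_plusPart J i x) (r : ℂ)
      have hr' := apply_embed_smul (apply_minusPart J hij x) (r : ℂ)
      rw [i.embed_ofReal] at hr hr'
      refine decomposition_unique hij (apply_plusPart J i _) (apply_minusPart J hij _) hr hr' ?_
      rw [plusPart_add_smul_minusPart, hx, rightSMul_rightSMul, Quaternion.coe_commutes,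
        ← rightSMul_rightSMul, ← smul_add, plusPart_add_smul_minusPart]
    have hp : plusPart J i x ∈ qEigenspace P.1 r := by
      rw [mem_qEigenspace, commutantOp_apply_plusPart, hunique.1]
    have hm : minusPart J i j x ∈ qEigenspace P.1 r := by
      rw [mem_qEigenspace, commutantOp_apply_minusPart, hunique.2]
    obtain ⟨y, hy, hyx⟩ := key ⟨HPlus.of _ (apply_plusPart J i x),
      (vec_mem_qEigenspace_iff P r _).1 hp⟩
    obtain ⟨y', hy', hyx'⟩ := key ⟨HPlus.of _ (apply_minusPart J hij x),
      (vec_mem_qEigenspace_iff P r _).1 hm⟩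
    have hsum : (⟨x, (mem_qEigenspace _ _ _).2 hx⟩ : qEigenspace P.1 r) = y + op j.val • y' := by
      refine Subtype.ext ?_
      rw [Submodule.coe_add, Submodule.coe_smul, hyx, hyx']
      exact (plusPart_add_smul_minusPart J i j x).symm
    rw [hsum]
    exact Submodule.add_mem _ hy (Submodule.smul_mem _ _ hy')
  rw [← b.mk_eq_rank'', ← (Module.Basis.mk hli hspan).mk_eq_rank'']

/-- The restriction of |T| is a positive root of S*S, hence |S|, and both enumerations depend only
on ranks of eigenspaces for real numbers, which agree. -/
theorem singularValue_resJ (T : commutantOp J) :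
    singularValue (resJ J i T) = qSingularValue T.1 := by
  obtain ⟨j, hij⟩ := i.exists_anticommuting
  rw [singularValue_eq_decreasingEnum (resJ_nonneg (P := ⟨qabs T.1, qabs_mem_commutantOp T⟩)
    (qabs_spec T.1).1) (resJ_qabs_mul_self T), qSingularValue]
  congr 1
  funext r
  exact (rank_qEigenspace hij ⟨qabs T.1, qabs_mem_commutantOp T⟩ r).symm

theorem resJ_mem_schattenClass_iff (p : ℝ≥0∞) (T : commutantOp J) :
    resJ J i T ∈ schattenClass (HPlus J i) p ↔ T.1 ∈ qSchattenClass J p := by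
  obtain ⟨j, hij⟩ := i.exists_anticommuting
  have h := isCompactOperator_resJ_iff J hij T
  constructor
  · rintro ⟨h1, h2⟩
    exact ⟨h.1 h1, T.2, by rwa [← singularValue_resJ (i := i)]⟩
  · rintro ⟨h1, -, h2⟩
    exact ⟨h.2 h1, by rwa [singularValue_resJ]⟩

end Restriction

end

theorem mainTheorem2 {H : Type*} [NormedAddCommGroup H] [Module ℍ[ℝ]ᵐᵒᵖ H]
    [QuaternionicInnerProductSpace H] [CompleteSpace H] [TopologicalSpace.SeparableSpace H]
    (J : AntiSelfadjointUnitary H) (i : ImaginaryUnit) (p : ℝ≥0∞) (hp : 0 < p) :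
    ∃ (V : Submodule ℂ (commutantOp J)) (W : Submodule ℂ (HPlus J i →L[ℂ] HPlus J i)),
      Subtype.val '' (V : Set (commutantOp J)) = qSchattenClass J p ∧
      (W : Set (HPlus J i →L[ℂ] HPlus J i)) = schattenClass (HPlus J i) p ∧
      (∃ Φ : V ≃ₗ[ℂ] W,
        (∀ T : V, (Φ T : HPlus J i →L[ℂ] HPlus J i) = resJ J i T) ∧
        (∀ T : V, schattenNorm p (Φ T : HPlus J i →L[ℂ] HPlus J i) =
          qSchattenNorm p (T : commutantOp J).1)) ∧
      (1 ≤ p →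
        IsBanachNorm (fun T : V => qSchattenNorm p (T : commutantOp J).1) ∧
        IsBanachNorm (fun T : W => schattenNorm p (T : HPlus J i →L[ℂ] HPlus J i))) := by
  obtain ⟨j, hij⟩ := i.exists_anticommuting
  let W := schattenSubmodule (HPlus J i) p hp
  -- As a preimage under a linear bijection, `V` is automatically a subspace isomorphic to `W`; its
  -- identification with S_p(J) comes from the equality of singular values.
  let V := W.comap (resJ J i)
  let Φ : V ≃ₗ[ℂ] W := LinearEquiv.ofBijective
    ((resJ J i).restrict (p := V) (q := W) fun _ hT => hT)
    ⟨fun S T h => Subtype.ext (resJ_injective J hij (congrArg Subtype.val h)), fun S => by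
      obtain ⟨T, hT⟩ := exists_extension J hij S.1
      exact ⟨⟨T, show resJ J i T ∈ W by rw [hT]; exact S.2⟩, Subtype.ext hT⟩⟩
  have hΦ : ∀ T : V, (Φ T : HPlus J i →L[ℂ] HPlus J i) = resJ J i T := fun _ => rfl
  have hnorm : ∀ T : V, schattenNorm p (Φ T : HPlus J i →L[ℂ] HPlus J i) =
      qSchattenNorm p (T : commutantOp J).1 := fun T => by
    rw [hΦ, schattenNorm, singularValue_resJ, qSchattenNorm]
  refine ⟨V, W, ?_, rfl, ⟨Φ, hΦ, hnorm⟩, fun hp1 => ?_⟩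
  · ext T
    constructor
    · rintro ⟨T, hT, rfl⟩
      exact (resJ_mem_schattenClass_iff p T).1 hT
    · intro hT
      exact ⟨⟨T, hT.2.1⟩, (resJ_mem_schattenClass_iff p ⟨T, hT.2.1⟩).2 hT, rfl⟩
  · have hW := isBanachNorm_schattenNorm (K := HPlus J i) hp1 hp
    have hV := hW.comp_linearEquiv Φ
    simp only [hnorm] at hV
    exact ⟨hV, hW⟩
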